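/- A graphon is a triple $(W,S,\mu)$ where $(S,\mu)$ is a $\sigma$-finite measure space and $W:S\times S\to\mathbb R$ is symmetric and integrable with respect to $\mu\times\mu$ (it may be unbounded and signed). The cut norm of $F\in L^1(S\times S,\mu\times\mu)$ is $$\|F\|_{\square}=\sup_{T,U}\Big|\int_{T\times U}F\,d(\mu\times\mu)\Big|,$$ the supremum being over measurable $T,U\subseteq S$. The cut metric $\delta_\square(W_1,W_2)$ of two graphons $(W_i,S_i,\mu_i)$ is defined as follows. If $\mu_1(S_1)=\mu_2(S_2)$, it is the infimum, over all measures $\gamma$ on $S_1\times S_2$ with marginals $\mu_1$ and $\mu_2$, of the cut norm with respect to $\gamma$ of $W_1(x_1,y_1)-W_2(x_2,y_2)$, as a function of the two points $(x_1,x_2),(y_1,y_2)\in S_1\times S_2$. Otherwise, replace both graphons first by trivial extensions (extensions by $0$ to larger $\sigma$-finite measure spaces) whose spaces have the same total mass; the value does not depend on the choice of the extensions. Theorem. Let $\mathcal W$ be a set of graphons (possibly on different measure spaces). The following are equivalent. (i) $\mathcal W$ is totally bounded for the cut metric: for every $\varepsilon>0$ there is a finite set $N$ of graphons such that every $W\in\mathcal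 W$ satisfies $\delta_\square(W,V)<\varepsilon$ for some $V\in N$. (ii) $\mathcal W$ is uniformly cut-regular, that is, for every $\varepsilon>0$ there is $B<\infty$ such that for every $(W,S,\mu)\in\mathcal W$ there is a graphon $V$ on $(S,\mu)$ with $|V|\le B$ and $\|W-V\|_\square<\varepsilon$; and $\mathcal W$ has uniformly cut-regular tails, that is, for every $\varepsilon>0$ there is $M<\infty$ such that for every $(W,S,\mu)\in\mathcal W$ there is a measurable $U\subseteq S$ with $\mu(U)\le M$ and $\|W-W\mathbf 1_{U\times U}\|_\square<\varepsilon$. (iii) For every $\varepsilon>0$ there are $M<\infty$ and $B<\infty$ such that for every $(W,S,\mu)\in\mathcal W$ there are a measurable $U\subseteq S$ with $\mu(U)\le M$ and a graphon $V$ on $(S,\mu)$ with $|V|\le B\,\mathbf 1_{U\times U}$ and $\|W-V\|_\square<\varepsilon$. -/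

import Mathlib

open MeasureTheory Set
open scoped NNReal ENNReal

/-- The cut norm of `F` on `S × S`: the supremum of `|∫_{T × U} F d(μ × μ)|` over all measurable
`T, U ⊆ S`, as an extended nonnegative number. It is used only for integrable `F`, where it is
finite (at most the `L¹` norm of `F`). -/
noncomputable def cutNorm {S : Type*} [MeasurableSpace S] (μ : Measure S) (F : S × S → ℝ) : ℝ≥0∞ :=
  ⨆ (T : Set S) (_ : MeasurableSet T) (U : Set S) (_ : MeasurableSet U),
    ENNReal.ofReal |∫ p in T ×ˢ U, F p ∂(μ.prod μ)|

/-- A (possibly signed, possibly unbounded) graphon on the measure space `(S, μ)`, as a predicate: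
a symmetric function `S × S → ℝ` that is integrable for `μ × μ`. -/
structure IsGraphon {S : Type*} [MeasurableSpace S] (μ : Measure S) (W : S × S → ℝ) : Prop where
  symm : ∀ x y, W (x, y) = W (y, x)
  integrable : Integrable W (μ.prod μ)

universe u

/-- A graphon `(W, S, μ)`, including its σ-finite measure space. -/
structure Graphon where
  S : Type u
  [measurableSpace : MeasurableSpace S]
  μ : Measure S
  [sigmaFinite : SigmaFinite μ]
  W : S × S → ℝ
  isGraphon : IsGraphon μ W

attribute [instance] Graphon.measurableSpace Graphon.sigmaFinite

/-- The pull-back `W^φ(x, y) = W(φ x, φ y)`. -/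
def pullback {S₁ S₂ : Type*} (φ : S₁ → S₂) (W : S₂ × S₂ → ℝ) : S₁ × S₁ → ℝ :=
  fun p => W (φ p.1, φ p.2)

/-- `γ` is a coupling measure of `μ₁` and `μ₂`: a measure on `S₁ × S₂` with marginals `μ₁` and
`μ₂`. -/
def IsCouplingMeasure {S₁ S₂ : Type*} [MeasurableSpace S₁] [MeasurableSpace S₂]
    (γ : Measure (S₁ × S₂)) (μ₁ : Measure S₁) (μ₂ : Measure S₂) : Prop :=
  γ.map Prod.fst = μ₁ ∧ γ.map Prod.snd = μ₂

/-- The infimum of the cut norms of `W₁^π₁ - W₂^π₂` over all coupling measures. Coupling measures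
exist when the two spaces have the same total mass. -/
noncomputable def couplingDist (W₁ W₂ : Graphon.{u}) : ℝ≥0∞ :=
  ⨅ (γ : Measure (W₁.S × W₂.S)) (_ : IsCouplingMeasure γ W₁.μ W₂.μ),
    cutNorm γ (pullback Prod.fst W₁.W - pullback Prod.snd W₂.W)

/-- The measure on the disjoint union `S ⊔ ℝ` given by `μ` on `S` and by Lebesgue measure on
`ℝ`. -/
noncomputable def extMeasure {S : Type*} [MeasurableSpace S] (μ : Measure S) :
    Measure (S ⊕ ℝ) :=
  μ.map Sum.inl + (volume : Measure ℝ).map Sum.inr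

/-- The extension of a function on `S × S` by zero to `(S ⊔ ℝ)²`. -/
def extFun {S : Type*} (W : S × S → ℝ) : (S ⊕ ℝ) × (S ⊕ ℝ) → ℝ
  | (Sum.inl x, Sum.inl y) => W (x, y)
  | _ => 0

theorem measurableEmbedding_inl {S : Type*} [MeasurableSpace S] :
    MeasurableEmbedding (Sum.inl : S → S ⊕ ℝ) :=
  ⟨Sum.inl_injective, measurable_inl, fun _ hs => measurableSet_inl_image.2 hs⟩

theorem measurableEmbedding_inr {S : Type*} [MeasurableSpace S] :
    MeasurableEmbedding (Sum.inr : ℝ → S ⊕ ℝ) :=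
  ⟨Sum.inr_injective, measurable_inr, fun _ hs => measurableSet_inr_image.2 hs⟩

theorem sigmaFinite_extMeasure {S : Type*} [MeasurableSpace S] (μ : Measure S) [SigmaFinite μ] :
    SigmaFinite (extMeasure μ) := by
  have h1 : SigmaFinite (μ.map (Sum.inl : S → S ⊕ ℝ)) :=
    measurableEmbedding_inl.sigmaFinite_map
  have h2 : SigmaFinite ((volume : Measure ℝ).map (Sum.inr : ℝ → S ⊕ ℝ)) :=
    measurableEmbedding_inr.sigmaFinite_map
  unfold extMeasure
  infer_instance

theorem isGraphon_extFun {S : Type*} [MeasurableSpace S] {μ : Measure S} [SigmaFinite μ]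
    {W : S × S → ℝ} (h : IsGraphon μ W) : IsGraphon (extMeasure μ) (extFun W) := by
  refine ⟨?_, ?_⟩
  · rintro (x | x) (y | y)
    · exact h.symm x y
    · rfl
    · rfl
    · rfl
  · have hS : MeasurableSet (range (Sum.inl : S → S ⊕ ℝ)) := measurableSet_range_inl
    have he : MeasurableEmbedding (Sum.inl : S → S ⊕ ℝ) := measurableEmbedding_inl
    have hi : MeasurableEmbedding (Prod.map Sum.inl Sum.inl : S × S → (S ⊕ ℝ) × (S ⊕ ℝ)) :=
      he.prodMap he
    have hr : (extMeasure μ).restrict (range Sum.inl) = μ.map Sum.inl := by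
      ext A hA
      rw [Measure.restrict_apply hA, extMeasure, Measure.add_apply, he.map_apply,
        measurableEmbedding_inr.map_apply, he.map_apply]
      have h1 : (Sum.inl : S → S ⊕ ℝ) ⁻¹' (A ∩ range Sum.inl) = Sum.inl ⁻¹' A := by
        ext x; simp
      have h2 : (Sum.inr : ℝ → S ⊕ ℝ) ⁻¹' (A ∩ range Sum.inl) = ∅ := by
        ext x; simp
      rw [h1, h2, measure_empty, add_zero]
    have := sigmaFinite_extMeasure μ
    have hp : ((extMeasure μ).prod (extMeasure μ)).restrict (range Sum.inl ×ˢ range Sum.inl)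
        = (μ.prod μ).map (Prod.map Sum.inl Sum.inl) := by
      rw [← Measure.prod_restrict, hr, Measure.map_prod_map _ _ he.measurable he.measurable]
    have hz : (range Sum.inl ×ˢ range Sum.inl).indicator (extFun W) = extFun W := by
      refine indicator_eq_self.2 ?_
      rintro ⟨x | x, y | y⟩ hxy <;> simp_all [extFun]
    rw [← hz, integrable_indicator_iff (hS.prod hS), IntegrableOn, hp, hi.integrable_map_iff]
    exact h.integrable

/-- A trivial extension of a graphon: its space is extended by a disjoint copy of `ℝ` with Lebesgue
measure, so that the total mass becomes infinite, and the graphon is extended by `0`. -/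
noncomputable def Graphon.trivialExtension (W : Graphon.{u}) : Graphon.{u} :=
  haveI := sigmaFinite_extMeasure W.μ
  { S := W.S ⊕ ℝ
    μ := extMeasure W.μ
    W := extFun W.W
    isGraphon := isGraphon_extFun W.isGraphon }

/-- The cut metric. If the underlying spaces have the same total mass, it is the infimum over
coupling measures; otherwise both graphons are first replaced by trivial extensions to spaces of the
same (infinite) total mass. (The value does not depend on the choice of the extensions.) -/
noncomputable def cutDist (W₁ W₂ : Graphon.{u}) : ℝ≥0∞ :=
  if W₁.μ univ = W₂.μ univ then couplingDist W₁ W₂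
  else couplingDist W₁.trivialExtension W₂.trivialExtension

/-- Total boundedness for the cut metric: for every `ε > 0` there is a finite `ε`-net (of graphons,
not necessarily in the set). -/
def CutTotallyBounded (𝒲 : Set Graphon.{u}) : Prop :=
  ∀ ε : ℝ, 0 < ε → ∃ N : Set Graphon.{u}, N.Finite ∧
    ∀ W ∈ 𝒲, ∃ V ∈ N, cutDist W V < ENNReal.ofReal ε

/-- Uniform cut-regularity: uniform approximability in cut norm by uniformly bounded graphons on
the same measure space. -/
def UniformlyCutRegular (𝒲 : Set Graphon.{u}) : Prop :=
  ∀ ε : ℝ, 0 < ε → ∃ B : ℝ≥0, ∀ W ∈ 𝒲, ∃ V : W.S × W.S → ℝ,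
    IsGraphon W.μ V ∧ (∀ p, |V p| ≤ B) ∧ cutNorm W.μ (W.W - V) < ENNReal.ofReal ε

/-- Uniformly cut-regular tails: for every `ε > 0` there is `M < ∞` such that each graphon in the
set is within `ε` in cut norm of its restriction `W · 1_{U × U}` for some `U` with `μ(U) ≤ M`. -/
def HasUniformlyCutRegularTails (𝒲 : Set Graphon.{u}) : Prop :=
  ∀ ε : ℝ, 0 < ε → ∃ M : ℝ≥0, ∀ W ∈ 𝒲, ∃ U : Set W.S,
    MeasurableSet U ∧ W.μ U ≤ M ∧
      cutNorm W.μ (W.W - (U ×ˢ U).indicator W.W) < ENNReal.ofReal ε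

/-! Condition (iii), here `UniformlyTruncatable`, is the hub. It is equivalent to (ii) because
restricting to a rectangle never increases the cut norm; the work lies in (i) ⇔ (iii).

From (i) to (iii): suppose W is close to V in a coupling γ. By `IsGraphon.exists_truncation` V may
be taken bounded by B and supported on A × A with A of finite measure. The conditional expectation
V' of V onto the space of W is again bounded by B, and it is close to W because only cylinder test
sets are involved. Its support may still be too large. Let f(x) be the conditional probability,
given x, that the partner of x lies in A. Its integral is the mass of A, so {f ≥ δ} has measure at
most ν(A)/δ by Markov. Over {f < δ}, an integral of V' is an integral of V over pairs whose first
partner lies in A. Closeness in γ, tested on this non-cylinder set, replaces V by W, and W then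
appears with the weight f < δ, which costs at most 2δ times its cut norm. This is
`exists_truncation_of_coupling`. The bounds depend on V only, so a finite net gives uniform ones.

From (iii) to (i): the weak regularity lemma, proved by energy decrement, replaces each truncated
graphon by a step graphon whose matrix comes from a finite list
(`exists_cutNorm_sub_pullback_patternMatrix_le`). Two step graphons with the same matrix and nearly
equal class masses are close: couple each class with its namesake, and couple the excess with the
class `o` on which the matrix vanishes and which the trivial extension makes infinite
(`exists_isCouplingMeasure_labels`, `lintegral_matrix_sub_le`). Rounding the masses to a grid leaves
finitely many finite weighted graphons. -/

/-! ### Cut norm: elementary estimates and pull-backs. -/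

section CutNorm

variable {S : Type*} [MeasurableSpace S] {μ : Measure S} {F G : S × S → ℝ}

theorem ofReal_abs_setIntegral_le_cutNorm {T U : Set S} (hT : MeasurableSet T)
    (hU : MeasurableSet U) :
    ENNReal.ofReal |∫ p in T ×ˢ U, F p ∂(μ.prod μ)| ≤ cutNorm μ F :=
  le_iSup₂_of_le T hT (le_iSup₂_of_le U hU le_rfl)

theorem cutNorm_le {c : ℝ≥0∞} (h : ∀ T U : Set S, MeasurableSet T → MeasurableSet U →
    ENNReal.ofReal |∫ p in T ×ˢ U, F p ∂(μ.prod μ)| ≤ c) : cutNorm μ F ≤ c :=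
  iSup₂_le fun T hT => iSup₂_le fun U hU => h T U hT hU

theorem abs_setIntegral_le_of_cutNorm_le {c : ℝ} (hc : 0 ≤ c)
    (h : cutNorm μ F ≤ ENNReal.ofReal c) {T U : Set S} (hT : MeasurableSet T)
    (hU : MeasurableSet U) : |∫ p in T ×ˢ U, F p ∂(μ.prod μ)| ≤ c :=
  (ENNReal.ofReal_le_ofReal_iff hc).1 ((ofReal_abs_setIntegral_le_cutNorm hT hU).trans h)

theorem cutNorm_add_le (hF : Integrable F (μ.prod μ)) (hG : Integrable G (μ.prod μ)) :
    cutNorm μ (F + G) ≤ cutNorm μ F + cutNorm μ G := by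
  refine cutNorm_le fun T U hT hU => ?_
  have : ∫ p in T ×ˢ U, (F + G) p ∂(μ.prod μ)
      = (∫ p in T ×ˢ U, F p ∂(μ.prod μ)) + ∫ p in T ×ˢ U, G p ∂(μ.prod μ) :=
    integral_add hF.integrableOn hG.integrableOn
  rw [this]
  refine (ENNReal.ofReal_le_ofReal (abs_add_le _ _)).trans ?_
  rw [ENNReal.ofReal_add (abs_nonneg _) (abs_nonneg _)]
  exact add_le_add (ofReal_abs_setIntegral_le_cutNorm hT hU)
    (ofReal_abs_setIntegral_le_cutNorm hT hU)

theorem cutNorm_sub_le {H : S × S → ℝ} (hF : Integrable F (μ.prod μ))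
    (hG : Integrable G (μ.prod μ)) (hH : Integrable H (μ.prod μ)) :
    cutNorm μ (F - H) ≤ cutNorm μ (F - G) + cutNorm μ (G - H) := by
  have : F - H = (F - G) + (G - H) := by abel
  rw [this]
  exact cutNorm_add_le (hF.sub hG) (hG.sub hH)

theorem cutNorm_le_lintegral : cutNorm μ F ≤ ∫⁻ p, ‖F p‖ₑ ∂(μ.prod μ) := by
  refine cutNorm_le fun T U _ _ => ?_
  rw [← Real.norm_eq_abs, ofReal_norm]
  exact (enorm_integral_le_lintegral_enorm _).trans (setLIntegral_le_lintegral _ _)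

theorem cutNorm_le_ofReal_integral (hF : Integrable F (μ.prod μ)) :
    cutNorm μ F ≤ ENNReal.ofReal (∫ p, |F p| ∂(μ.prod μ)) := by
  refine cutNorm_le_lintegral.trans_eq ?_
  exact (ofReal_integral_norm_eq_lintegral_enorm hF).symm

theorem cutNorm_congr_ae (h : F =ᵐ[μ.prod μ] G) : cutNorm μ F = cutNorm μ G := by
  have : ∀ s : Set (S × S), ∫ p in s, F p ∂(μ.prod μ) = ∫ p in s, G p ∂(μ.prod μ) :=
    fun s => integral_congr_ae (ae_restrict_of_ae h)
  simp only [cutNorm, this]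

/-- The intersection of two rectangles is a rectangle, so the restricted function is tested against
a subfamily of the same test sets. -/
theorem cutNorm_indicator_le {A B : Set S} (hA : MeasurableSet A) (hB : MeasurableSet B) :
    cutNorm μ ((A ×ˢ B).indicator F) ≤ cutNorm μ F := by
  refine cutNorm_le fun T U hT hU => ?_
  rw [setIntegral_indicator (hA.prod hB), prod_inter_prod]
  exact ofReal_abs_setIntegral_le_cutNorm (hT.inter hA) (hU.inter hB)

theorem cutNorm_indicator_eq_restrict [SFinite μ] {U : Set S} (hU : MeasurableSet U) :
    cutNorm μ ((U ×ˢ U).indicator F) = cutNorm (μ.restrict U) F := by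
  unfold cutNorm
  congr! 7 with T hT T' hT'
  rw [setIntegral_indicator (hU.prod hU), Measure.prod_restrict,
    Measure.restrict_restrict (hT.prod hT')]

/-- A set that is not a union of fibres of a measure preserving map can be replaced by one without
decreasing the absolute value of the integral of a function that is constant on fibres. -/
theorem exists_measurableSet_abs_setIntegral_comp_le {X : Type*} [MeasurableSpace X]
    {γ : Measure X} {φ : X → S} (hφ : MeasurePreserving φ γ μ) {h : S → ℝ}
    (hh : Integrable h μ) (T : Set X) :
    ∃ T' : Set S, MeasurableSet T' ∧ |∫ x in T, h (φ x) ∂γ| ≤ |∫ y in T', h y ∂μ| := by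
  have key : ∀ k : S → ℝ, Integrable k μ → ∃ T' : Set S, MeasurableSet T' ∧
      ∫ x in T, k (φ x) ∂γ ≤ ∫ y in T', k y ∂μ := by
    intro k hk
    obtain ⟨m, hm, hkm⟩ := hk.aestronglyMeasurable
    have hms : MeasurableSet {y | 0 ≤ m y} := hm.measurable measurableSet_Ici
    -- The positivity set of a measurable version of `k`: the integral of `k ∘ φ` over any set is at
    -- most that of its positive part, which descends to the base.
    refine ⟨{y | 0 ≤ m y}, hms, ?_⟩
    have hpos : Integrable (fun y => max (k y) 0) μ := hk.pos_part
    have hpos' : Integrable (fun x => max (k (φ x)) 0) γ := hφ.integrable_comp_of_integrable hpos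
    have hk' : Integrable (fun x => k (φ x)) γ := hφ.integrable_comp_of_integrable hk
    calc ∫ x in T, k (φ x) ∂γ ≤ ∫ x in T, max (k (φ x)) 0 ∂γ :=
          integral_mono hk'.integrableOn hpos'.integrableOn fun x => le_max_left _ _
      _ ≤ ∫ x, max (k (φ x)) 0 ∂γ :=
          setIntegral_le_integral hpos' (Filter.Eventually.of_forall fun x => le_max_right _ _)
      _ = ∫ y, max (k y) 0 ∂μ := by
          rw [← hφ.map_eq]
          exact (integral_map hφ.aemeasurable (by rw [hφ.map_eq]; exact hpos.1)).symm
      _ = ∫ y in {y | 0 ≤ m y}, k y ∂μ := by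
          rw [← integral_indicator hms]
          refine integral_congr_ae ?_
          filter_upwards [hkm] with y hy
          by_cases h0 : 0 ≤ k y
          · rw [indicator_of_mem (by simpa [← hy] using h0), max_eq_left h0]
          · rw [indicator_of_notMem (by simpa [← hy] using h0), max_eq_right (not_le.1 h0).le]
  rcases le_total 0 (∫ x in T, h (φ x) ∂γ) with h0 | h0
  · obtain ⟨T', hT', hle⟩ := key h hh
    exact ⟨T', hT', by rw [abs_of_nonneg h0]; exact hle.trans (le_abs_self _)⟩
  · obtain ⟨T', hT', hle⟩ := key (-h) hh.neg
    refine ⟨T', hT', ?_⟩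
    simp only [Pi.neg_apply, integral_neg] at hle
    rw [abs_of_nonpos h0]
    exact hle.trans (neg_le_abs _)

theorem integrable_pullback {X : Type*} [MeasurableSpace X] {γ : Measure X} [SigmaFinite γ]
    [SigmaFinite μ] {φ : X → S} (hφ : MeasurePreserving φ γ μ) (hF : Integrable F (μ.prod μ)) :
    Integrable (pullback φ F) (γ.prod γ) :=
  (hφ.prod hφ).integrable_comp_of_integrable hF

/-- Pulling back along a measure preserving map does not increase the cut norm. -/
theorem cutNorm_pullback_le {X : Type*} [MeasurableSpace X] {γ : Measure X} [SigmaFinite γ]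
    [SigmaFinite μ] {φ : X → S} (hφ : MeasurePreserving φ γ μ) (hF : Integrable F (μ.prod μ)) :
    cutNorm γ (pullback φ F) ≤ cutNorm μ F := by
  refine cutNorm_le fun T U hT hU => ?_
  have h1 : Integrable (fun p : S × X => F (p.1, φ p.2)) (μ.prod γ) :=
    ((MeasurePreserving.id μ).prod hφ).integrable_comp_of_integrable hF
  have h1' : Integrable (fun x => ∫ q in U, F (x, φ q) ∂γ) μ := by
    have : Integrable (fun p : S × X => F (p.1, φ p.2)) (μ.prod (γ.restrict U)) := by
      have := h1.integrableOn (s := univ ×ˢ U)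
      rwa [IntegrableOn, ← Measure.prod_restrict, Measure.restrict_univ] at this
    exact this.integral_prod_left
  -- The two test sets are replaced one at a time: with `U` fixed the inner integral is a function
  -- on the base, so `T` descends; then Fubini exchanges the roles and `U` descends.
  obtain ⟨T', hT', hle⟩ := exists_measurableSet_abs_setIntegral_comp_le hφ h1' T
  have h2' : Integrable (fun y => ∫ x in T', F (x, y) ∂μ) μ := by
    have : Integrable F ((μ.restrict T').prod μ) := by
      have := hF.integrableOn (s := T' ×ˢ univ)
      rwa [IntegrableOn, ← Measure.prod_restrict, Measure.restrict_univ] at this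
    exact this.integral_prod_right
  obtain ⟨U', hU', hle'⟩ := exists_measurableSet_abs_setIntegral_comp_le hφ h2' U
  refine le_trans (ENNReal.ofReal_le_ofReal ?_) (ofReal_abs_setIntegral_le_cutNorm hT' hU')
  have e1 : ∫ p in T ×ˢ U, pullback φ F p ∂(γ.prod γ)
      = ∫ p in T, ∫ q in U, F (φ p, φ q) ∂γ ∂γ :=
    setIntegral_prod _ (integrable_pullback hφ hF).integrableOn
  have e2 : ∫ x in T', ∫ q in U, F (x, φ q) ∂γ ∂μ = ∫ q in U, ∫ x in T', F (x, φ q) ∂μ ∂γ := by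
    rw [← setIntegral_prod (fun p : S × X => F (p.1, φ p.2)) h1.integrableOn,
      ← setIntegral_prod_swap,
      setIntegral_prod (fun p : X × S => F (p.swap.1, φ p.swap.2)) h1.swap.integrableOn]
    rfl
  have e3 : ∫ y in U', ∫ x in T', F (x, y) ∂μ ∂μ = ∫ p in T' ×ˢ U', F p ∂(μ.prod μ) := by
    rw [← setIntegral_prod_swap, setIntegral_prod (fun p : S × S => F p.swap) hF.swap.integrableOn]
    rfl
  rw [e1, ← e3]
  exact hle.trans (e2 ▸ hle')

end CutNorm

/-! ### Conditions (ii) and (iii) are equivalent. -/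

/-- Uniform approximability in cut norm by uniformly bounded graphons that vanish outside squares
of sets of uniformly bounded measure. -/
def UniformlyTruncatable (𝒲 : Set Graphon.{u}) : Prop :=
  ∀ ε : ℝ, 0 < ε → ∃ M B : ℝ≥0, ∀ W ∈ 𝒲, ∃ (U : Set W.S) (V : W.S × W.S → ℝ),
    MeasurableSet U ∧ W.μ U ≤ M ∧ IsGraphon W.μ V ∧
      (∀ p, |V p| ≤ (U ×ˢ U).indicator (fun _ => (B : ℝ)) p) ∧
      cutNorm W.μ (W.W - V) < ENNReal.ofReal ε

theorem IsGraphon.indicator {S : Type*} [MeasurableSpace S] {μ : Measure S} {W : S × S → ℝ}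
    (h : IsGraphon μ W) {U : Set S} (hU : MeasurableSet U) :
    IsGraphon μ ((U ×ˢ U).indicator W) := by
  classical
  refine ⟨fun x y => ?_, h.integrable.indicator (hU.prod hU)⟩
  simp only [indicator_apply, mem_prod, h.symm x y, and_comm]

theorem eq_zero_of_abs_le_indicator {X : Type*} {s : Set X} {V : X → ℝ} {B : ℝ}
    (h : ∀ p, |V p| ≤ s.indicator (fun _ => B) p) {p : X} (hp : p ∉ s) : V p = 0 := by
  have := h p
  rw [indicator_of_notMem hp] at this
  exact abs_nonpos_iff.1 this

theorem UniformlyTruncatable.uniformlyCutRegular {𝒲 : Set Graphon.{u}}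
    (h : UniformlyTruncatable 𝒲) : UniformlyCutRegular 𝒲 := by
  intro ε hε
  obtain ⟨M, B, h⟩ := h ε hε
  refine ⟨B, fun W hW => ?_⟩
  obtain ⟨U, V, -, -, hV, hb, hc⟩ := h W hW
  exact ⟨V, hV, fun p => (hb p).trans (indicator_le_self' (fun _ _ => B.2) p), hc⟩

theorem UniformlyTruncatable.hasUniformlyCutRegularTails {𝒲 : Set Graphon.{u}}
    (h : UniformlyTruncatable 𝒲) : HasUniformlyCutRegularTails 𝒲 := by
  classical
  intro ε hε
  obtain ⟨M, B, h⟩ := h (ε / 2) (half_pos hε)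
  refine ⟨M, fun W hW => ?_⟩
  obtain ⟨U, V, hU, hM, hV, hb, hc⟩ := h W hW
  refine ⟨U, hU, hM, ?_⟩
  have hi : Integrable (W.W - V) (W.μ.prod W.μ) := W.isGraphon.integrable.sub hV.integrable
  -- Off U × U the graphon V vanishes, so W agrees there with W - V. The complement of the square is
  -- a union of two disjoint rectangles, and each costs one cut norm of W - V.
  have e : W.W - (U ×ˢ U).indicator W.W
      = (Uᶜ ×ˢ univ).indicator (W.W - V) + (U ×ˢ Uᶜ).indicator (W.W - V) := by
    funext p
    have h0 : p ∉ U ×ˢ U → V p = 0 := fun hp => eq_zero_of_abs_le_indicator hb hp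
    simp only [mem_prod] at h0
    by_cases h1 : p.1 ∈ U <;> by_cases h2 : p.2 ∈ U <;>
      simp_all [indicator_apply]
  rw [e]
  calc _ ≤ cutNorm W.μ ((Uᶜ ×ˢ univ).indicator (W.W - V))
        + cutNorm W.μ ((U ×ˢ Uᶜ).indicator (W.W - V)) :=
        cutNorm_add_le (hi.indicator (hU.compl.prod .univ)) (hi.indicator (hU.prod hU.compl))
    _ ≤ cutNorm W.μ (W.W - V) + cutNorm W.μ (W.W - V) :=
        add_le_add (cutNorm_indicator_le hU.compl .univ) (cutNorm_indicator_le hU hU.compl)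
    _ < ENNReal.ofReal (ε / 2) + ENNReal.ofReal (ε / 2) := ENNReal.add_lt_add hc hc
    _ = ENNReal.ofReal ε := by
        rw [← ENNReal.ofReal_add (half_pos hε).le (half_pos hε).le, add_halves]

theorem UniformlyCutRegular.uniformlyTruncatable {𝒲 : Set Graphon.{u}}
    (h : UniformlyCutRegular 𝒲) (h' : HasUniformlyCutRegularTails 𝒲) :
    UniformlyTruncatable 𝒲 := by
  intro ε hε
  obtain ⟨B, h⟩ := h (ε / 2) (half_pos hε)
  obtain ⟨M, h'⟩ := h' (ε / 2) (half_pos hε)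
  refine ⟨M, B, fun W hW => ?_⟩
  obtain ⟨V, hV, hb, hc⟩ := h W hW
  obtain ⟨U, hU, hM, hc'⟩ := h' W hW
  refine ⟨U, (U ×ˢ U).indicator V, hU, hM, hV.indicator hU, fun p => ?_, ?_⟩
  · by_cases hp : p ∈ U ×ˢ U
    · rw [indicator_of_mem hp, indicator_of_mem hp]
      exact hb p
    · rw [indicator_of_notMem hp, indicator_of_notMem hp, abs_zero]
  · have hW' := W.isGraphon.integrable
    calc _ ≤ cutNorm W.μ (W.W - (U ×ˢ U).indicator W.W)
          + cutNorm W.μ ((U ×ˢ U).indicator W.W - (U ×ˢ U).indicator V) :=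
          cutNorm_sub_le hW' (hW'.indicator (hU.prod hU)) (hV.integrable.indicator (hU.prod hU))
      _ ≤ cutNorm W.μ (W.W - (U ×ˢ U).indicator W.W) + cutNorm W.μ (W.W - V) := by
          have : (U ×ˢ U).indicator W.W - (U ×ˢ U).indicator V
              = (U ×ˢ U).indicator (W.W - V) := (indicator_sub (U ×ˢ U) W.W V).symm
          rw [this]
          exact add_le_add le_rfl (cutNorm_indicator_le hU hU)
      _ < ENNReal.ofReal (ε / 2) + ENNReal.ofReal (ε / 2) := ENNReal.add_lt_add hc' hc
      _ = ENNReal.ofReal ε := by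
          rw [← ENNReal.ofReal_add (half_pos hε).le (half_pos hε).le, add_halves]

/-! ### Conditional expectation along measure preserving maps. -/

theorem sigmaFinite_of_le {S : Type*} [MeasurableSpace S] {ρ : Measure S} (μ : Measure S)
    [SigmaFinite μ] (h : ρ ≤ μ) : SigmaFinite ρ :=
  ⟨⟨⟨spanningSets μ, fun _ => trivial, fun n => (h _).trans_lt (measure_spanningSets_lt_top μ n),
    iUnion_spanningSets μ⟩⟩⟩

section CondExp

variable {S X : Type*} [MeasurableSpace S] [MeasurableSpace X] {μ : Measure S} [SigmaFinite μ]
  {γ : Measure X} {φ : X → S}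

/-- Conditional expectation along a measure preserving map, for functions with values in `[0, B]`. -/
theorem exists_setLIntegral_eq_setLIntegral_preimage (hφ : MeasurePreserving φ γ μ)
    {G : X → ℝ≥0∞} {B : ℝ≥0} (hG : ∀ x, G x ≤ B) :
    ∃ g : S → ℝ≥0∞, Measurable g ∧ (∀ y, g y ≤ B) ∧
      ∀ E, MeasurableSet E → ∫⁻ y in E, g y ∂μ = ∫⁻ x in φ ⁻¹' E, G x ∂γ := by
  -- The conditional expectation is the Radon–Nikodym density of this measure; domination by `B • μ`
  -- gives both σ-finiteness and the bound `B`.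
  set ρ : Measure S := (γ.withDensity G).map φ with hρ
  have hρE : ∀ E, MeasurableSet E → ρ E = ∫⁻ x in φ ⁻¹' E, G x ∂γ := fun E hE => by
    rw [hρ, Measure.map_apply hφ.measurable hE, withDensity_apply _ (hφ.measurable hE)]
  have hle : ρ ≤ B • μ := by
    refine Measure.le_iff.2 fun E hE => ?_
    rw [hρE E hE, ← hφ.map_eq, Measure.smul_apply, Measure.map_apply hφ.measurable hE]
    calc ∫⁻ x in φ ⁻¹' E, G x ∂γ ≤ ∫⁻ _ in φ ⁻¹' E, (B : ℝ≥0∞) ∂γ := lintegral_mono hG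
      _ = B • γ (φ ⁻¹' E) := by rw [setLIntegral_const]; rfl
  have hac : ρ ≪ μ := hle.absolutelyContinuous.trans (Measure.smul_absolutelyContinuous)
  have : SigmaFinite (B • μ) := inferInstance
  have : SigmaFinite ρ := sigmaFinite_of_le _ hle
  have hb : ρ.rnDeriv μ ≤ᵐ[μ] fun _ => (B : ℝ≥0∞) := by
    refine ae_le_of_forall_setLIntegral_le_of_sigmaFinite (ρ.measurable_rnDeriv μ)
      fun s _ _ => (Measure.setLIntegral_rnDeriv_le s).trans ((hle s).trans_eq ?_)
    rw [setLIntegral_const]; rfl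
  -- The density is at most `B` only almost everywhere; the minimum makes the bound hold everywhere.
  refine ⟨fun y => min (ρ.rnDeriv μ y) B, (ρ.measurable_rnDeriv μ).min measurable_const,
    fun y => min_le_right _ _, fun E hE => ?_⟩
  rw [← hρE E hE, ← Measure.setLIntegral_rnDeriv hac E]
  refine lintegral_congr_ae (ae_restrict_of_ae ?_)
  filter_upwards [hb] with y hy using min_eq_left hy

/-- Conditional expectation along a measure preserving map, for bounded integrable functions. -/
theorem exists_setIntegral_eq_setIntegral_preimage (hφ : MeasurePreserving φ γ μ)
    {G : X → ℝ} (hGi : Integrable G γ) {B : ℝ≥0} (hG : ∀ x, |G x| ≤ B) :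
    ∃ g : S → ℝ, Integrable g μ ∧ (∀ y, |g y| ≤ B) ∧
      ∀ E, MeasurableSet E → ∫ y in E, g y ∂μ = ∫ x in φ ⁻¹' E, G x ∂γ := by
  have hb : ∀ H : X → ℝ, (∀ x, |H x| ≤ B) → ∀ x, ENNReal.ofReal (H x) ≤ B := fun H hH x =>
    (ENNReal.ofReal_le_ofReal ((le_abs_self _).trans (hH x))).trans_eq ENNReal.ofReal_coe_nnreal
  obtain ⟨g₁, hm₁, hb₁, h₁⟩ := exists_setLIntegral_eq_setLIntegral_preimage hφ (hb G hG)
  obtain ⟨g₂, hm₂, hb₂, h₂⟩ := exists_setLIntegral_eq_setLIntegral_preimage hφ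
    (hb (-G) fun x => by simpa using hG x)
  have hi : ∀ H : X → ℝ, Integrable H γ → ∀ g : S → ℝ≥0∞, Measurable g →
      (∀ E, MeasurableSet E →
        ∫⁻ y in E, g y ∂μ = ∫⁻ x in φ ⁻¹' E, ENNReal.ofReal (H x) ∂γ) →
      Integrable (fun y => (g y).toReal) μ := fun H hH g hg h => by
    refine integrable_toReal_of_lintegral_ne_top hg.aemeasurable ?_
    have := h univ .univ
    rw [Measure.restrict_univ, preimage_univ, Measure.restrict_univ] at this
    rw [this]
    refine (lt_of_le_of_lt ?_ hH.hasFiniteIntegral).ne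
    exact lintegral_mono fun x => Real.ofReal_le_enorm _
  have hi₁ := hi G hGi g₁ hm₁ h₁
  have hi₂ := hi (-G) hGi.neg g₂ hm₂ h₂
  have hle : ∀ g : S → ℝ≥0∞, (∀ y, g y ≤ B) → ∀ y, (g y).toReal ≤ B := fun g hg y =>
    ENNReal.toReal_mono ENNReal.coe_ne_top (hg y)
  refine ⟨fun y => (g₁ y).toReal - (g₂ y).toReal, hi₁.sub hi₂, fun y => ?_, fun E hE => ?_⟩
  · exact abs_sub_le_of_nonneg_of_le ENNReal.toReal_nonneg (hle _ hb₁ y) ENNReal.toReal_nonneg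
      (hle _ hb₂ y)
  · have hlt : ∀ g : S → ℝ≥0∞, (∀ y, g y ≤ B) → ∀ᵐ y ∂(μ.restrict E), g y < ∞ := fun g hg =>
      Filter.Eventually.of_forall fun y => (hg y).trans_lt ENNReal.coe_lt_top
    rw [integral_sub hi₁.integrableOn hi₂.integrableOn,
      integral_toReal hm₁.aemeasurable (hlt _ hb₁), integral_toReal hm₂.aemeasurable (hlt _ hb₂),
      h₁ E hE, h₂ E hE, integral_eq_lintegral_pos_part_sub_lintegral_neg_part hGi.integrableOn]
    rfl

/-- Conditional expectation of a bounded graphon along a measure preserving map. -/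
theorem IsGraphon.exists_condExp [SigmaFinite γ] (hφ : MeasurePreserving φ γ μ)
    {G : X × X → ℝ} (hGi : IsGraphon γ G) {B : ℝ≥0} (hG : ∀ x, |G x| ≤ B) :
    ∃ V : S × S → ℝ, IsGraphon μ V ∧ (∀ p, |V p| ≤ B) ∧
      ∀ T U, MeasurableSet T → MeasurableSet U → ∫ p in T ×ˢ U, V p ∂(μ.prod μ)
        = ∫ p in (φ ⁻¹' T) ×ˢ (φ ⁻¹' U), G p ∂(γ.prod γ) := by
  obtain ⟨g, hg, hb, h⟩ := exists_setIntegral_eq_setIntegral_preimage (hφ.prod hφ) hGi.integrable hG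
  have hs : Integrable (fun p : S × S => g p.swap) (μ.prod μ) := hg.swap
  -- A graphon must be symmetric at every point, which a density need not be; symmetrising changes
  -- no rectangle integral because `G` is symmetric.
  refine ⟨fun p => (g p + g p.swap) / 2, ⟨fun x y => by simp [add_comm], (hg.add hs).div_const 2⟩,
    fun p => ?_, fun T U hT hU => ?_⟩
  · rw [abs_div, abs_two, div_le_iff₀ two_pos]
    exact (abs_add_le _ _).trans (by linarith [hb p, hb p.swap])
  · rw [integral_div, integral_add hg.integrableOn hs.integrableOn, h _ (hT.prod hU),
      setIntegral_prod_swap, h _ (hU.prod hT)]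
    have e : ∫ p in (Prod.map φ φ) ⁻¹' (U ×ˢ T), G p ∂(γ.prod γ)
        = ∫ p in (φ ⁻¹' T) ×ˢ (φ ⁻¹' U), G p ∂(γ.prod γ) := by
      rw [← setIntegral_prod_swap]
      refine integral_congr_ae (Filter.Eventually.of_forall fun p => ?_)
      exact hGi.symm _ _
    rw [e]
    have e' : Prod.map φ φ ⁻¹' (T ×ˢ U) = (φ ⁻¹' T) ×ˢ (φ ⁻¹' U) := rfl
    rw [e', add_self_div_two]

end CondExp

/-! ### Total boundedness gives uniform truncation. -/

section Truncation

/-- The L¹ norm is the sum of the contributions of the positivity set and of its complement, and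
each is the absolute value of a test integral. -/
theorem integral_abs_le_two_mul {S : Type*} [MeasurableSpace S] {μ : Measure S} {h : S → ℝ}
    (hh : Integrable h μ) {c : ℝ} (hc : ∀ T, MeasurableSet T → |∫ x in T, h x ∂μ| ≤ c) :
    ∫ x, |h x| ∂μ ≤ 2 * c := by
  obtain ⟨m, hm, hhm⟩ := hh.aestronglyMeasurable
  have hT : MeasurableSet {x | 0 ≤ m x} := hm.measurable measurableSet_Ici
  rw [← integral_add_compl hT hh.abs]
  have h1 : ∫ x in {x | 0 ≤ m x}, |h x| ∂μ = ∫ x in {x | 0 ≤ m x}, h x ∂μ := by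
    refine setIntegral_congr_ae hT ?_
    filter_upwards [hhm] with x hx h0
    rw [abs_of_nonneg (by rw [hx]; exact h0)]
  have h2 : ∫ x in {x | 0 ≤ m x}ᶜ, |h x| ∂μ = -∫ x in {x | 0 ≤ m x}ᶜ, h x ∂μ := by
    rw [← integral_neg]
    refine setIntegral_congr_ae hT.compl ?_
    filter_upwards [hhm] with x hx h0
    rw [abs_of_neg (by rw [hx]; exact not_le.1 h0)]
  rw [h1, h2]
  have := (le_abs_self _).trans (hc _ hT)
  have := (neg_le_abs _).trans (hc _ hT.compl)
  linarith

theorem setIntegral_pullback {S X : Type*} [MeasurableSpace S] [MeasurableSpace X] {μ : Measure S}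
    [SigmaFinite μ] {γ : Measure X} [SigmaFinite γ] {φ : X → S} (hφ : MeasurePreserving φ γ μ)
    {F : S × S → ℝ} (hF : Integrable F (μ.prod μ)) {T U : Set S} (hT : MeasurableSet T)
    (hU : MeasurableSet U) :
    ∫ p in (φ ⁻¹' T) ×ˢ (φ ⁻¹' U), pullback φ F p ∂(γ.prod γ) = ∫ p in T ×ˢ U, F p ∂(μ.prod μ) := by
  have h := hφ.prod hφ
  conv_rhs => rw [← h.map_eq]
  rw [setIntegral_map (hT.prod hU) (by rw [h.map_eq]; exact hF.1) h.aemeasurable]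
  rfl

/-- If a graphon is close, in a coupling, to a bounded graphon that vanishes off `A × A` with `A` of
finite measure, then it is close in cut norm to a bounded graphon that vanishes outside the square
of a set of finite measure, with quantitative bounds. -/
theorem exists_truncation_of_coupling {X Y : Type*} [MeasurableSpace X] [MeasurableSpace Y]
    {μ : Measure X} [SigmaFinite μ] {ν : Measure Y} [SigmaFinite ν] {γ : Measure (X × Y)}
    (hγ : IsCouplingMeasure γ μ ν) {W : X × X → ℝ} (hW : IsGraphon μ W) {V : Y × Y → ℝ}
    (hV : IsGraphon ν V) {A : Set Y} (hA : MeasurableSet A) {B : ℝ≥0}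
    (hVb : ∀ p, |V p| ≤ (A ×ˢ A).indicator (fun _ => (B : ℝ)) p) {e c : ℝ} (he : 0 ≤ e)
    (hc : 0 ≤ c) (hVc : cutNorm ν V ≤ ENNReal.ofReal c)
    (hWV : cutNorm γ (pullback Prod.fst W - pullback Prod.snd V) ≤ ENNReal.ofReal e)
    {δ : ℝ} (hδ : 0 < δ) :
    ∃ (U : Set X) (V' : X × X → ℝ), MeasurableSet U ∧ μ U ≤ ν A / ENNReal.ofReal δ ∧
      IsGraphon μ V' ∧ (∀ p, |V' p| ≤ (U ×ˢ U).indicator (fun _ => (B : ℝ)) p) ∧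
      cutNorm μ (W - V') ≤ ENNReal.ofReal (3 * e + 4 * δ * (e + c)) := by
  classical
  have h1 : MeasurePreserving Prod.fst γ μ := ⟨measurable_fst, hγ.1⟩
  have h2 : MeasurePreserving Prod.snd γ ν := ⟨measurable_snd, hγ.2⟩
  have : SigmaFinite γ :=
    SigmaFinite.of_map γ measurable_fst.aemeasurable (by rw [hγ.1]; infer_instance)
  have hWi := integrable_pullback h1 hW.integrable
  have hVi := integrable_pullback h2 hV.integrable
  have hGb : ∀ p : (X × Y) × (X × Y), |pullback Prod.snd V p| ≤ B := fun p =>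
    (hVb _).trans (indicator_le_self' (fun _ _ => B.2) _)
  obtain ⟨V', hV', hV'b, hV'i⟩ := IsGraphon.exists_condExp (γ := γ) h1
    (G := pullback Prod.snd V) ⟨fun _ _ => hV.symm _ _, hVi⟩ hGb
  have hWV' : cutNorm μ (W - V') ≤ ENNReal.ofReal e := by
    refine cutNorm_le fun T U hT hU => le_trans (le_of_eq ?_)
      ((ofReal_abs_setIntegral_le_cutNorm (measurable_fst hT) (measurable_fst hU)).trans hWV)
    have : ∫ p in T ×ˢ U, (W - V') p ∂(μ.prod μ)
        = ∫ p in (Prod.fst ⁻¹' T) ×ˢ (Prod.fst ⁻¹' U),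
            (pullback Prod.fst W - pullback Prod.snd V : (X × Y) × (X × Y) → ℝ) p ∂(γ.prod γ) := by
      simp only [Pi.sub_apply]
      rw [integral_sub hW.integrable.integrableOn hV'.integrable.integrableOn,
        integral_sub hWi.integrableOn hVi.integrableOn, hV'i T U hT hU,
        setIntegral_pullback h1 hW.integrable hT hU]
    rw [this]
  have hV'c : cutNorm μ V' ≤ ENNReal.ofReal c := by
    refine cutNorm_le fun T U hT hU => ?_
    rw [hV'i T U hT hU]
    exact (ofReal_abs_setIntegral_le_cutNorm (measurable_fst hT) (measurable_fst hU)).trans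
      ((cutNorm_pullback_le h2 hV.integrable).trans hVc)
  have hWc : cutNorm μ W ≤ ENNReal.ofReal (e + c) := by
    have : W = (W - V') + V' := by abel
    rw [this, ENNReal.ofReal_add he hc]
    exact (cutNorm_add_le (hW.integrable.sub hV'.integrable) hV'.integrable).trans
      (add_le_add hWV' hV'c)
  have hec : 0 ≤ e + c := add_nonneg he hc
  -- The density of ρ is the conditional probability that the partner of `x` lies in `A`; its total
  -- mass is that of `A`, so Markov's inequality bounds the set where it is at least `δ`.
  set ρ : Measure X := (γ.restrict (Prod.snd ⁻¹' A)).map Prod.fst with hρ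
  have hρle : ρ ≤ μ := by
    rw [← hγ.1]
    exact Measure.map_mono Measure.restrict_le_self measurable_fst
  have hρac : ρ ≪ μ := hρle.absolutelyContinuous
  have : SigmaFinite ρ := sigmaFinite_of_le μ hρle
  set f : X → ℝ≥0∞ := ρ.rnDeriv μ with hf
  have hfm : Measurable f := ρ.measurable_rnDeriv μ
  set U₀ : Set X := {x | ENNReal.ofReal δ ≤ f x} with hU₀
  have hU₀m : MeasurableSet U₀ := hfm measurableSet_Ici
  have hμU₀ : μ U₀ ≤ ν A / ENNReal.ofReal δ := by
    refine (meas_ge_le_lintegral_div hfm.aemeasurable (ENNReal.ofReal_pos.2 hδ).ne'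
      ENNReal.ofReal_ne_top).trans (ENNReal.div_le_div_right ?_ _)
    refine (Measure.lintegral_rnDeriv_le).trans_eq ?_
    rw [hρ, Measure.map_apply measurable_fst .univ, preimage_univ, Measure.restrict_apply_univ,
      ← hγ.2, Measure.map_apply measurable_snd hA]
  -- The key estimate. Since V vanishes off A × A, the strip can be cut down to `Z`, where the
  -- partner of the first point lies in `A`. Passing from V to W on it costs `e`, and the remaining
  -- integral of W carries the density of ρ, less than `δ`, as a weight.
  have hsmall : ∀ T U, MeasurableSet T → MeasurableSet U →
      |∫ p in (T ∩ U₀ᶜ) ×ˢ U, V' p ∂(μ.prod μ)| ≤ e + 2 * δ * (e + c) := by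
    intro T U hT hU
    set D := T ∩ U₀ᶜ with hD
    have hDm : MeasurableSet D := hT.inter hU₀m.compl
    set Z : Set (X × Y) := Prod.fst ⁻¹' D ∩ Prod.snd ⁻¹' A with hZ
    have hZm : MeasurableSet Z := (measurable_fst hDm).inter (measurable_snd hA)
    have e1 : ∫ p in D ×ˢ U, V' p ∂(μ.prod μ)
        = ∫ p in Z ×ˢ (Prod.fst ⁻¹' U), pullback Prod.snd V p ∂(γ.prod γ) := by
      rw [hV'i D U hDm hU, ← integral_indicator ((measurable_fst hDm).prod (measurable_fst hU)),
        ← integral_indicator (hZm.prod (measurable_fst hU))]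
      congr 1
      funext p
      simp only [indicator_apply, mem_prod, hZ, mem_inter_iff, mem_preimage]
      by_cases hp : p.1.2 ∈ A
      · simp [hp]
      · have : pullback Prod.snd V p = 0 := eq_zero_of_abs_le_indicator hVb fun h => hp h.1
        simp [this]
    have e2 : |∫ p in Z ×ˢ (Prod.fst ⁻¹' U),
        (pullback Prod.fst W - pullback Prod.snd V : (X × Y) × (X × Y) → ℝ) p ∂(γ.prod γ)| ≤ e :=
      abs_setIntegral_le_of_cutNorm_le he hWV hZm (measurable_fst hU)
    simp only [Pi.sub_apply] at e2
    rw [integral_sub hWi.integrableOn hVi.integrableOn, ← e1] at e2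
    set h : X → ℝ := fun x => ∫ y in U, W (x, y) ∂μ with hh
    have hhi : Integrable h μ := by
      have : Integrable W (μ.prod (μ.restrict U)) := by
        have := hW.integrable.integrableOn (s := univ ×ˢ U)
        rwa [IntegrableOn, ← Measure.prod_restrict, Measure.restrict_univ] at this
      exact this.integral_prod_left
    have e3 : ∫ p in Z ×ˢ (Prod.fst ⁻¹' U), pullback Prod.fst W p ∂(γ.prod γ)
        = ∫ x in D, (f x).toReal • h x ∂μ := by
      rw [setIntegral_rnDeriv_smul hρac hDm, hρ, setIntegral_map hDm
        (hhi.1.mono_ac hρac) measurable_fst.aemeasurable,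
        Measure.restrict_restrict (measurable_fst hDm), setIntegral_prod _ hWi.integrableOn]
      have hae : ∀ᵐ p ∂γ, AEStronglyMeasurable (fun y => W (p.1, y)) μ := by
        have := hW.integrable.prod_right_ae
        exact h1.quasiMeasurePreserving.ae (this.mono fun x hx => hx.1)
      refine integral_congr_ae (ae_restrict_of_ae ?_)
      filter_upwards [hae] with p hp
      simp only [hh]
      conv_rhs => rw [← hγ.1]
      rw [setIntegral_map hU (by rw [hγ.1]; exact hp) measurable_fst.aemeasurable]
      rfl
    have hfD : ∀ x ∈ D, (f x).toReal ≤ δ := fun x hx => by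
      have : f x < ENNReal.ofReal δ := not_le.1 hx.2
      exact ENNReal.toReal_le_of_le_ofReal hδ.le this.le
    have e4 : |∫ x in D, (f x).toReal • h x ∂μ| ≤ 2 * δ * (e + c) := by
      calc |∫ x in D, (f x).toReal • h x ∂μ| ≤ ∫ x in D, δ * |h x| ∂μ := by
            rw [← Real.norm_eq_abs]
            refine norm_integral_le_of_norm_le (hhi.abs.const_mul δ).integrableOn ?_
            filter_upwards [ae_restrict_mem hDm] with x hx
            rw [norm_smul, Real.norm_of_nonneg ENNReal.toReal_nonneg, Real.norm_eq_abs]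
            exact mul_le_mul_of_nonneg_right (hfD x hx) (abs_nonneg _)
        _ ≤ ∫ x, δ * |h x| ∂μ := setIntegral_le_integral (hhi.abs.const_mul δ)
            (Filter.Eventually.of_forall fun x => mul_nonneg hδ.le (abs_nonneg _))
        _ = δ * ∫ x, |h x| ∂μ := integral_const_mul _ _
        _ ≤ δ * (2 * (e + c)) := by
            refine mul_le_mul_of_nonneg_left (integral_abs_le_two_mul hhi fun T' hT' => ?_) hδ.le
            rw [← setIntegral_prod W hW.integrable.integrableOn]
            exact abs_setIntegral_le_of_cutNorm_le hec hWc hT' hU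
        _ = 2 * δ * (e + c) := by ring
    rw [← e3] at e4
    rw [abs_le] at e2 e4 ⊢
    constructor <;> linarith
  have hnn : 0 ≤ e + 2 * δ * (e + c) := by positivity
  refine ⟨U₀, (U₀ ×ˢ U₀).indicator V', hU₀m, hμU₀, hV'.indicator hU₀m, fun p => ?_, ?_⟩
  · by_cases hp : p ∈ U₀ ×ˢ U₀
    · rw [indicator_of_mem hp, indicator_of_mem hp]
      exact hV'b p
    · rw [indicator_of_notMem hp, indicator_of_notMem hp, abs_zero]
  · have hi := hV'.integrable
    have e0 : W - (U₀ ×ˢ U₀).indicator V'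
        -- The first term costs `e` and each strip `e + 2δ(e + c)`, which gives `3e + 4δ(e + c)`.
        = (W - V') + ((U₀ᶜ ×ˢ univ).indicator V' + (U₀ ×ˢ U₀ᶜ).indicator V') := by
      funext p
      by_cases h1 : p.1 ∈ U₀ <;> by_cases h2 : p.2 ∈ U₀ <;> simp [h1, h2]
    have hi1 := hi.indicator (hU₀m.compl.prod .univ)
    have hi2 := hi.indicator (hU₀m.prod hU₀m.compl)
    have c1 : cutNorm μ ((U₀ᶜ ×ˢ univ).indicator V') ≤ ENNReal.ofReal (e + 2 * δ * (e + c)) := by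
      refine cutNorm_le fun T U hT hU => ENNReal.ofReal_le_ofReal ?_
      rw [setIntegral_indicator (hU₀m.compl.prod .univ), prod_inter_prod, inter_univ]
      exact hsmall T U hT hU
    have c2 : cutNorm μ ((U₀ ×ˢ U₀ᶜ).indicator V') ≤ ENNReal.ofReal (e + 2 * δ * (e + c)) := by
      refine cutNorm_le fun T U hT hU => ENNReal.ofReal_le_ofReal ?_
      rw [setIntegral_indicator (hU₀m.prod hU₀m.compl), prod_inter_prod, ← setIntegral_prod_swap]
      refine le_trans (le_of_eq ?_) (hsmall U (T ∩ U₀) hU (hT.inter hU₀m))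
      congr 2
      funext p
      exact hV'.symm _ _
    rw [e0]
    calc _ ≤ ENNReal.ofReal e + (ENNReal.ofReal (e + 2 * δ * (e + c))
          + ENNReal.ofReal (e + 2 * δ * (e + c))) :=
          (cutNorm_add_le (hW.integrable.sub hi) (hi1.add hi2)).trans
            (add_le_add hWV' ((cutNorm_add_le hi1 hi2).trans (add_le_add c1 c2)))
      _ = ENNReal.ofReal (3 * e + 4 * δ * (e + c)) := by
          rw [← ENNReal.ofReal_add hnn hnn, ← ENNReal.ofReal_add he (by positivity)]
          congr 1
          ring

/-- Every graphon is close in cut norm to a bounded one that vanishes outside the square of a set of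
finite measure. -/
theorem IsGraphon.exists_truncation {S : Type*} [MeasurableSpace S] {μ : Measure S} [SigmaFinite μ]
    {W : S × S → ℝ} (hW : IsGraphon μ W) {ε : ℝ} (hε : 0 < ε) :
    ∃ (A : Set S) (B : ℝ≥0) (V : S × S → ℝ), MeasurableSet A ∧ μ A < ∞ ∧ IsGraphon μ V ∧
      (∀ p, |V p| ≤ (A ×ˢ A).indicator (fun _ => (B : ℝ)) p) ∧
      cutNorm μ (W - V) ≤ ENNReal.ofReal ε := by
  classical
  set A : ℕ → Set S := spanningSets μ
  have hA : ∀ n, MeasurableSet (A n) := measurableSet_spanningSets μ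
  -- Clamp the values to [-n, n] and cut off to the square of the n-th spanning set. At each point
  -- the sequence is eventually equal to W, and it is dominated by |W|, so it converges in L¹.
  set V : ℕ → S × S → ℝ := fun n =>
    (A n ×ˢ A n).indicator fun p => max (-(n : ℝ)) (min (n : ℝ) (W p)) with hVdef
  have hVW : ∀ (n : ℕ) p, |max (-(n : ℝ)) (min (n : ℝ) (W p))| ≤ |W p| := fun n p => by
    have hn : (0 : ℝ) ≤ n := Nat.cast_nonneg n
    rcases le_total 0 (W p) with h | h
    · rw [abs_of_nonneg h, abs_of_nonneg (le_max_of_le_right (le_min hn h))]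
      exact max_le (by linarith) (min_le_right _ _)
    · rw [abs_of_nonpos h, abs_of_nonpos (max_le (by linarith) ((min_le_right _ _).trans h))]
      exact neg_le_neg (le_max_of_le_right (le_min (by linarith) le_rfl))
  have hVW' : ∀ n p, |V n p| ≤ |W p| := fun n p => by
    by_cases hp : p ∈ A n ×ˢ A n
    · simp only [hVdef, indicator_of_mem hp]
      exact hVW n p
    · simp only [hVdef, indicator_of_notMem hp, abs_zero, abs_nonneg]
  have hm : ∀ n, AEStronglyMeasurable (V n) (μ.prod μ) := fun n =>
    (aestronglyMeasurable_const.sup (aestronglyMeasurable_const.inf hW.integrable.1)).indicator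
      ((hA n).prod (hA n))
  have hV : ∀ n, IsGraphon μ (V n) := fun n =>
    ⟨fun x y => by simp only [hVdef, indicator_apply, mem_prod, hW.symm x y, and_comm],
      hW.integrable.mono (hm n) (Filter.Eventually.of_forall (hVW' n))⟩
  have hlim : Filter.Tendsto (fun n => ∫ p, |W p - V n p| ∂(μ.prod μ)) Filter.atTop (nhds 0) := by
    have := tendsto_integral_of_dominated_convergence (F := fun n p => |W p - V n p|)
      (f := fun _ => 0) (μ := μ.prod μ) (fun p => 2 * |W p|)
      (fun n => (hW.integrable.sub (hV n).integrable).abs.1) (hW.integrable.abs.const_mul 2)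
      (fun n => Filter.Eventually.of_forall fun p => by
        rw [Real.norm_eq_abs, abs_abs]
        have := abs_sub (W p) (V n p)
        linarith [hVW' n p])
      (Filter.Eventually.of_forall fun p => by
        obtain ⟨k, hk⟩ := exists_nat_ge |W p|
        refine tendsto_const_nhds.congr' ?_
        filter_upwards [Filter.eventually_ge_atTop
          (max k (max (spanningSetsIndex μ p.1) (spanningSetsIndex μ p.2)))] with n hn
        have h1 : p ∈ A n ×ˢ A n :=
          ⟨mem_spanningSets_of_index_le μ _ (by omega), mem_spanningSets_of_index_le μ _ (by omega)⟩
        have hkn : |W p| ≤ n := hk.trans (by exact_mod_cast (by omega : k ≤ n))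
        simp only [hVdef, indicator_of_mem h1]
        rw [min_eq_right (abs_le.1 hkn).2, max_eq_right (abs_le.1 hkn).1, sub_self, abs_zero])
    simpa using this
  obtain ⟨n, hn⟩ := (hlim.eventually (gt_mem_nhds hε)).exists
  refine ⟨A n, n, V n, hA n, measure_spanningSets_lt_top μ n, hV n, fun p => ?_, ?_⟩
  · by_cases hp : p ∈ A n ×ˢ A n
    · simp only [hVdef, indicator_of_mem hp, NNReal.coe_natCast]
      exact abs_le.2 ⟨le_max_left _ _, max_le (by simp) (min_le_left _ _)⟩
    · simp only [hVdef, indicator_of_notMem hp, abs_zero, le_refl]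
  · exact (cutNorm_le_ofReal_integral (hW.integrable.sub (hV n).integrable)).trans
      (ENNReal.ofReal_le_ofReal hn.le)

/-- Graphons that are close to a given one in some coupling can be truncated uniformly. -/
theorem IsGraphon.exists_uniform_truncation {Y : Type*} [MeasurableSpace Y] {ν : Measure Y}
    [SigmaFinite ν] {V : Y × Y → ℝ} (hV : IsGraphon ν V) {ε : ℝ} (hε : 0 < ε) :
    ∃ M B : ℝ≥0, ∀ {X : Type u} [MeasurableSpace X] {μ : Measure X} [SigmaFinite μ]
      {W : X × X → ℝ} (_ : IsGraphon μ W) {γ : Measure (X × Y)} (_ : IsCouplingMeasure γ μ ν)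
      (_ : cutNorm γ (pullback Prod.fst W - pullback Prod.snd V) ≤ ENNReal.ofReal (ε / 16)),
      ∃ (U : Set X) (V' : X × X → ℝ), MeasurableSet U ∧ μ U ≤ M ∧ IsGraphon μ V' ∧
        (∀ p, |V' p| ≤ (U ×ˢ U).indicator (fun _ => (B : ℝ)) p) ∧
        cutNorm μ (W - V') < ENNReal.ofReal ε := by
  obtain ⟨A, B, V₀, hA, hAν, hV₀, hb, hVV₀⟩ := hV.exists_truncation (ε := ε / 16) (by positivity)
  set c := ∫ p, |V₀ p| ∂(ν.prod ν) with hc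
  have hc0 : 0 ≤ c := integral_nonneg fun p => abs_nonneg _
  -- Chosen so that `4δ(e + c) = ε / 8` for `e = ε / 8`; the total error is then `3ε / 8 + ε / 8 = ε
  -- / 2`.
  set δ := (ε / 8) / (4 * (ε / 8 + c)) with hδ
  have hδ0 : 0 < δ := by positivity
  refine ⟨(ν A / ENNReal.ofReal δ).toNNReal, B, ?_⟩
  intro X _ μ _ W hW γ hγ hWV
  have h1 : MeasurePreserving Prod.fst γ μ := ⟨measurable_fst, hγ.1⟩
  have h2 : MeasurePreserving Prod.snd γ ν := ⟨measurable_snd, hγ.2⟩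
  have : SigmaFinite γ :=
    SigmaFinite.of_map γ measurable_fst.aemeasurable (by rw [hγ.1]; infer_instance)
  have hWV₀ : cutNorm γ (pullback Prod.fst W - pullback Prod.snd V₀) ≤ ENNReal.ofReal (ε / 8) := by
    have e : ε / 8 = ε / 16 + ε / 16 := by ring
    rw [e, ENNReal.ofReal_add (by positivity) (by positivity)]
    exact (cutNorm_sub_le (integrable_pullback h1 hW.integrable)
      (integrable_pullback h2 hV.integrable) (integrable_pullback h2 hV₀.integrable)).trans
      (add_le_add hWV ((cutNorm_pullback_le h2 (hV.integrable.sub hV₀.integrable)).trans hVV₀))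
  obtain ⟨U, V', hU, hM, hV', hb', hWV'⟩ := exists_truncation_of_coupling hγ hW hV₀ hA hb
    (by positivity) hc0 (cutNorm_le_ofReal_integral hV₀.integrable) hWV₀ hδ0
  refine ⟨U, V', hU, ?_, hV', hb', hWV'.trans_lt ?_⟩
  · rwa [ENNReal.coe_toNNReal]
    exact (ENNReal.div_lt_top hAν.ne (ENNReal.ofReal_pos.2 hδ0).ne').ne
  · rw [ENNReal.ofReal_lt_ofReal_iff hε]
    have : 4 * δ * (ε / 8 + c) = ε / 8 := by
      rw [hδ]
      field_simp
    linarith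

end Truncation

/-! ### Trivial extensions and passage to the original space. -/

theorem indicator_extFun {S : Type*} (W : S × S → ℝ) :
    (range Sum.inl ×ˢ range Sum.inl).indicator (extFun W) = extFun W := by
  refine indicator_eq_self.2 ?_
  rintro ⟨x | x, y | y⟩ hxy <;> simp_all [extFun]

theorem extFun_sub {S : Type*} (V W : S × S → ℝ) : extFun (V - W) = extFun V - extFun W := by
  funext p
  rcases p with ⟨x | x, y | y⟩ <;> simp [extFun]

section Extension

variable {S : Type*} [MeasurableSpace S] {μ : Measure S}

theorem extMeasure_apply {E : Set (S ⊕ ℝ)} (hE : MeasurableSet E) :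
    extMeasure μ E = μ (Sum.inl ⁻¹' E) + volume (Sum.inr ⁻¹' E) := by
  rw [extMeasure, Measure.add_apply, Measure.map_apply measurable_inl hE,
    Measure.map_apply measurable_inr hE]

/-- This brings the results on pull-backs to bear on trivial extensions, once the extended measure
is restricted to the original part. -/
theorem measurePreserving_inl :
    MeasurePreserving (Sum.inl : S → S ⊕ ℝ) μ ((extMeasure μ).restrict (range Sum.inl)) := by
  refine ⟨measurable_inl, ?_⟩
  ext E hE
  rw [Measure.map_apply measurable_inl hE, Measure.restrict_apply hE,
    extMeasure_apply (hE.inter measurableSet_range_inl)]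
  have h1 : (Sum.inl : S → S ⊕ ℝ) ⁻¹' (E ∩ range Sum.inl) = Sum.inl ⁻¹' E := by
    ext x; simp
  have h2 : (Sum.inr : ℝ → S ⊕ ℝ) ⁻¹' (E ∩ range Sum.inl) = ∅ := by
    ext x; simp
  rw [h1, h2, measure_empty, add_zero]

theorem integrable_pullback_inl [SigmaFinite μ] {F : (S ⊕ ℝ) × (S ⊕ ℝ) → ℝ}
    (hF : Integrable F ((extMeasure μ).prod (extMeasure μ))) :
    Integrable (pullback Sum.inl F) (μ.prod μ) := by
  have := sigmaFinite_extMeasure μ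
  refine integrable_pullback measurePreserving_inl ?_
  rw [Measure.prod_restrict]
  exact hF.integrableOn

theorem cutNorm_pullback_inl_le [SigmaFinite μ] {F : (S ⊕ ℝ) × (S ⊕ ℝ) → ℝ}
    (hF : Integrable F ((extMeasure μ).prod (extMeasure μ))) :
    cutNorm μ (pullback Sum.inl F) ≤ cutNorm (extMeasure μ) F := by
  have := sigmaFinite_extMeasure μ
  refine (cutNorm_pullback_le measurePreserving_inl ?_).trans ?_
  · rw [Measure.prod_restrict]
    exact hF.integrableOn
  · rw [← cutNorm_indicator_eq_restrict measurableSet_range_inl]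
    exact cutNorm_indicator_le measurableSet_range_inl measurableSet_range_inl

theorem cutNorm_extFun_le [SigmaFinite μ] {W : S × S → ℝ} (hW : IsGraphon μ W) :
    cutNorm (extMeasure μ) (extFun W) ≤ cutNorm μ W := by
  have := sigmaFinite_extMeasure μ
  rw [← indicator_extFun, cutNorm_indicator_eq_restrict measurableSet_range_inl]
  refine cutNorm_le fun T U hT hU => ?_
  have hi : Integrable (extFun W) (((extMeasure μ).restrict (range Sum.inl)).prod
      ((extMeasure μ).restrict (range Sum.inl))) := by
    rw [Measure.prod_restrict]
    exact (isGraphon_extFun hW).integrable.integrableOn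
  rw [← setIntegral_pullback measurePreserving_inl hi hT hU]
  exact ofReal_abs_setIntegral_le_cutNorm (measurable_inl hT) (measurable_inl hU)

end Extension

/-- Which branch of `cutDist` applies depends on W, but the bounds may not. Both V and its trivial
extension are therefore treated, and the larger bounds are taken. In the extended case the
truncation is pulled back to the original space, which increases neither the measure of the set nor
the cut norm. -/
theorem Graphon.exists_uniform_truncation (V : Graphon.{u}) {ε : ℝ} (hε : 0 < ε) :
    ∃ M B : ℝ≥0, ∀ W : Graphon.{u}, cutDist W V < ENNReal.ofReal (ε / 16) →
      ∃ (U : Set W.S) (V' : W.S × W.S → ℝ), MeasurableSet U ∧ W.μ U ≤ M ∧ IsGraphon W.μ V' ∧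
        (∀ p, |V' p| ≤ (U ×ˢ U).indicator (fun _ => (B : ℝ)) p) ∧
        cutNorm W.μ (W.W - V') < ENNReal.ofReal ε := by
  obtain ⟨M₁, B₁, h₁⟩ := V.isGraphon.exists_uniform_truncation hε
  obtain ⟨M₂, B₂, h₂⟩ := V.trivialExtension.isGraphon.exists_uniform_truncation hε
  have mono : ∀ {X : Type u} {s : Set X} (B B' : ℝ≥0), B ≤ B' → ∀ p,
      s.indicator (fun _ => (B : ℝ)) p ≤ s.indicator (fun _ => (B' : ℝ)) p :=
    fun B B' h p => indicator_le_indicator (by exact_mod_cast h)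
  refine ⟨max M₁ M₂, max B₁ B₂, fun W hWV => ?_⟩
  unfold cutDist at hWV
  split_ifs at hWV
  · simp only [couplingDist, iInf_lt_iff] at hWV
    obtain ⟨γ, hγ, hlt⟩ := hWV
    obtain ⟨U, V', hU, hM, hV', hb, hc⟩ := h₁ W.isGraphon hγ hlt.le
    exact ⟨U, V', hU, hM.trans (by exact_mod_cast le_max_left _ _), hV',
      fun p => (hb p).trans (mono _ _ (le_max_left _ _) p), hc⟩
  · simp only [couplingDist, iInf_lt_iff] at hWV
    obtain ⟨γ, hγ, hlt⟩ := hWV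
    obtain ⟨U, V', hU, hM, hV', hb, hc⟩ := h₂ W.trivialExtension.isGraphon hγ hlt.le
    have hM' : extMeasure W.μ U ≤ M₂ := hM
    rw [extMeasure_apply hU] at hM'
    refine ⟨Sum.inl ⁻¹' U, pullback Sum.inl V', measurable_inl hU,
      (le_self_add.trans hM').trans (by exact_mod_cast le_max_right _ _),
      ⟨fun _ _ => hV'.symm _ _, integrable_pullback_inl hV'.integrable⟩,
      fun p => (hb _).trans ?_, ?_⟩
    · exact mono _ _ (le_max_right _ _) _
    · exact (cutNorm_pullback_inl_le
        ((isGraphon_extFun W.isGraphon).integrable.sub hV'.integrable)).trans_lt hc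

theorem CutTotallyBounded.uniformlyTruncatable {𝒲 : Set Graphon.{u}} (h : CutTotallyBounded 𝒲) :
    UniformlyTruncatable 𝒲 := by
  intro ε hε
  obtain ⟨N, hN, hcov⟩ := h (ε / 16) (by positivity)
  choose M B hMB using fun V : Graphon.{u} => V.exists_uniform_truncation hε
  obtain ⟨M₀, hM₀⟩ := (hN.image M).bddAbove
  obtain ⟨B₀, hB₀⟩ := (hN.image B).bddAbove
  refine ⟨M₀, B₀, fun W hW => ?_⟩
  obtain ⟨V, hV, hlt⟩ := hcov W hW
  obtain ⟨U, V', hU, hM, hV', hb, hc⟩ := hMB V W hlt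
  refine ⟨U, V', hU, hM.trans ?_, hV', fun p => (hb p).trans ?_, hc⟩
  · exact_mod_cast hM₀ (mem_image_of_mem M hV)
  · exact indicator_le_indicator (by exact_mod_cast hB₀ (mem_image_of_mem B hV))

/-! ### Couplings of measures of infinite mass. -/

section Coupling

/-- Two divergent series of nonnegative reals are the row and column sums of a matrix. -/
theorem exists_matrix_tsum_eq {a b : ℕ → ℝ≥0} (ha : ¬Summable a) (hb : ¬Summable b) :
    ∃ w : ℕ → ℕ → ℝ≥0∞, (∀ n, ∑' m, w n m = a n) ∧ ∀ m, ∑' n, w n m = b m := by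
  set s : (ℕ → ℝ≥0) → ℕ → ℝ := fun c n => ∑ i ∈ Finset.range n, (c i : ℝ) with hs
  -- Consecutive intervals of lengths `c n` tile the half-line when the series diverges; the matrix
  -- entries are the overlap lengths of the two tilings.
  set J : (ℕ → ℝ≥0) → ℕ → Set ℝ := fun c n => Ico (s c n) (s c (n + 1)) with hJ
  have hmono : ∀ c, Monotone (s c) := fun c => monotone_nat_of_le_succ fun n => by
    simp [hs, Finset.sum_range_succ]
  have hdisj : ∀ c, Pairwise (Function.onFun Disjoint (J c)) := fun c =>
    (hmono c).pairwise_disjoint_on_Ico_succ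
  have h0 : ∀ c, s c 0 = 0 := fun c => by simp [hs]
  have hUnion : ∀ c : ℕ → ℝ≥0, ¬Summable c → ⋃ n, J c n = Ici 0 := fun c hc => by
    have := iUnion_Ico_map_succ_eq_Ici (f := s c) (fun n => hmono c (Nat.zero_le n)) ?_
    · rwa [Nat.bot_eq_zero, h0] at this
    · rintro ⟨x, hx⟩
      refine hc (NNReal.summable_coe.1 ?_)
      exact summable_of_sum_range_le (c := x) (fun n => (c n).2) fun n => hx ⟨n, rfl⟩
  have hvol : ∀ c n, volume (J c n) = c n := fun c n => by
    rw [Real.volume_Ico, hs]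
    simp [Finset.sum_range_succ]
  have key : ∀ c d : ℕ → ℝ≥0, ¬Summable d → ∀ n, ∑' m, volume (J c n ∩ J d m) = c n := by
    intro c d hd n
    rw [← measure_iUnion (fun i j hij => ((hdisj d hij).inter_left' _).inter_right' _)
      fun m => measurableSet_Ico.inter measurableSet_Ico, ← inter_iUnion, hUnion d hd,
      inter_eq_left.2 ?_, hvol]
    exact fun x hx => (h0 c).symm.le.trans ((hmono c (Nat.zero_le n)).trans hx.1)
  refine ⟨fun n m => volume (J a n ∩ J b m), key a b hb, fun m => ?_⟩
  simp only [inter_comm (J a _)]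
  exact key b a ha m

/-- Two `s`-finite measures of infinite total mass have a coupling. -/
theorem exists_isCouplingMeasure {X Y : Type*} [MeasurableSpace X] [MeasurableSpace Y]
    (μ : Measure X) (ν : Measure Y) [SFinite μ] [SFinite ν] (hμ : μ univ = ∞) (hν : ν univ = ∞) :
    ∃ γ, IsCouplingMeasure γ μ ν := by
  set a : ℕ → ℝ≥0 := fun n => (sfiniteSeq μ n univ).toNNReal with ha
  set b : ℕ → ℝ≥0 := fun n => (sfiniteSeq ν n univ).toNNReal with hb
  have ha' : ∀ n, sfiniteSeq μ n univ = a n := fun n =>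
    (ENNReal.coe_toNNReal (measure_ne_top _ _)).symm
  have hb' : ∀ n, sfiniteSeq ν n univ = b n := fun n =>
    (ENNReal.coe_toNNReal (measure_ne_top _ _)).symm
  have has : ¬Summable a := fun h => ENNReal.tsum_coe_ne_top_iff_summable.2 h (by
    rw [← hμ, ← sum_sfiniteSeq μ, Measure.sum_apply _ .univ]
    simp only [ha'])
  have hbs : ¬Summable b := fun h => ENNReal.tsum_coe_ne_top_iff_summable.2 h (by
    rw [← hν, ← sum_sfiniteSeq ν, Measure.sum_apply _ .univ]
    simp only [hb'])
  obtain ⟨w, hwa, hwb⟩ := exists_matrix_tsum_eq has hbs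
  -- The coupling divides by `a n` and `b m`; where one of them is zero its inverse is ∞, and the
  -- vanishing weight annihilates the term.
  have hw0 : ∀ n m, a n = 0 ∨ b m = 0 → w n m = 0 := by
    rintro n m (h | h)
    · exact ENNReal.tsum_eq_zero.1 ((hwa n).trans (by rw [h, ENNReal.coe_zero])) m
    · exact ENNReal.tsum_eq_zero.1 ((hwb m).trans (by rw [h, ENNReal.coe_zero])) n
  have hcancel : ∀ c d : ℝ≥0, ∀ r : ℝ≥0∞, (d = 0 → r = 0) →
      r * ((c : ℝ≥0∞)⁻¹ * (d : ℝ≥0∞)⁻¹) * d = r * (c : ℝ≥0∞)⁻¹ := by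
    intro c d r h
    by_cases hd : d = 0
    · rw [h hd]; simp
    · rw [mul_assoc, mul_assoc, ENNReal.inv_mul_cancel (by simpa using hd) ENNReal.coe_ne_top,
        mul_one]
  have hone : ∀ c : ℝ≥0, ∀ x : ℝ≥0∞, x ≤ c → (c : ℝ≥0∞) * (c : ℝ≥0∞)⁻¹ * x = x := by
    intro c x hx
    by_cases hc : c = 0
    · have : x = 0 := by simpa [hc] using hx
      rw [this, mul_zero]
    · rw [ENNReal.mul_inv_cancel (by simpa using hc) ENNReal.coe_ne_top, one_mul]
  refine ⟨Measure.sum fun p : ℕ × ℕ => (w p.1 p.2 * ((a p.1 : ℝ≥0∞)⁻¹ * (b p.2 : ℝ≥0∞)⁻¹)) •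
    (sfiniteSeq μ p.1).prod (sfiniteSeq ν p.2), ?_, ?_⟩
  · ext E hE
    rw [Measure.map_sum measurable_fst.aemeasurable, Measure.sum_apply _ hE]
    conv_rhs => rw [← sum_sfiniteSeq μ, Measure.sum_apply _ hE]
    simp only [Measure.map_smul, Measure.map_fst_prod, Measure.smul_apply, smul_eq_mul, hb',
      ← mul_assoc]
    rw [ENNReal.tsum_prod']
    refine tsum_congr fun n => ?_
    calc ∑' m, w n m * (a n : ℝ≥0∞)⁻¹ * (b m : ℝ≥0∞)⁻¹ * b m * sfiniteSeq μ n E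
        = ∑' m, w n m * ((a n : ℝ≥0∞)⁻¹ * sfiniteSeq μ n E) := by
          refine tsum_congr fun m => ?_
          rw [mul_assoc (w n m), hcancel _ _ _ fun h => hw0 n m (Or.inr h), mul_assoc]
      _ = sfiniteSeq μ n E := by
          rw [ENNReal.tsum_mul_right, hwa, ← mul_assoc,
            hone _ _ ((measure_mono (subset_univ _)).trans_eq (ha' n))]
  · ext E hE
    rw [Measure.map_sum measurable_snd.aemeasurable, Measure.sum_apply _ hE]
    conv_rhs => rw [← sum_sfiniteSeq ν, Measure.sum_apply _ hE]
    simp only [Measure.map_smul, Measure.map_snd_prod, Measure.smul_apply, smul_eq_mul, ha',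
      ← mul_assoc]
    rw [ENNReal.tsum_prod', ENNReal.tsum_comm]
    refine tsum_congr fun m => ?_
    calc ∑' n, w n m * (a n : ℝ≥0∞)⁻¹ * (b m : ℝ≥0∞)⁻¹ * a n * sfiniteSeq ν m E
        = ∑' n, w n m * ((b m : ℝ≥0∞)⁻¹ * sfiniteSeq ν m E) := by
          refine tsum_congr fun n => ?_
          rw [mul_assoc (w n m), mul_comm (a n : ℝ≥0∞)⁻¹,
            hcancel _ _ _ fun h => hw0 n m (Or.inl h), mul_assoc]
      _ = sfiniteSeq ν m E := by
          rw [ENNReal.tsum_mul_right, hwb, ← mul_assoc,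
            hone _ _ ((measure_mono (subset_univ _)).trans_eq (hb' m))]

end Coupling

/-! ### Coupling labelled spaces, and comparing step functions with the same matrix. -/

section Labels

variable {L : Type*} [Fintype L] [MeasurableSpace L] [MeasurableSingletonClass L]

theorem sum_restrict_preimage_singleton {X : Type*} [MeasurableSpace X] (μ : Measure X)
    {s : X → L} (hs : Measurable s) : ∑ l, μ.restrict (s ⁻¹' {l}) = μ := by
  classical
  have h : ⋃ l, s ⁻¹' {l} = univ := by ext x; simp
  conv_rhs => rw [← Measure.restrict_univ (μ := μ), ← h]
  rw [Measure.restrict_iUnion (fun i j hij => Disjoint.preimage _ (by simpa using hij))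
    fun l => hs (measurableSet_singleton l), Measure.sum_fintype]

theorem restrict_add_sum_erase [DecidableEq L] {X : Type*} [MeasurableSpace X] (μ : Measure X)
    {s : X → L} (hs : Measurable s) (o : L) : μ.restrict (s ⁻¹' {o})
      + ∑ l ∈ Finset.univ.erase o, μ.restrict (s ⁻¹' {l}) = μ := by
  conv_rhs => rw [← sum_restrict_preimage_singleton μ hs]
  exact Finset.add_sum_erase _ (fun l => μ.restrict (s ⁻¹' {l})) (Finset.mem_univ o)

/-- If two labelled measure spaces give almost the same mass to each label except for one, which has
infinite mass, then they have a coupling in which almost all points have matching labels. -/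
theorem exists_isCouplingMeasure_labels {X Y : Type*} [MeasurableSpace X] [MeasurableSpace Y]
    (μ : Measure X) (ν : Measure Y) [SigmaFinite μ] [SigmaFinite ν] {s : X → L} {t : Y → L}
    (hs : Measurable s) (ht : Measurable t) {o : L} (hμo : μ (s ⁻¹' {o}) = ∞)
    (hνo : ν (t ⁻¹' {o}) = ∞) {η : ℝ≥0∞} (hfin : ∀ l ≠ o, μ (s ⁻¹' {l}) ≠ ∞)
    (hle : ∀ l ≠ o, ν (t ⁻¹' {l}) ≤ μ (s ⁻¹' {l}))
    (hη : ∀ l ≠ o, μ (s ⁻¹' {l}) ≤ ν (t ⁻¹' {l}) + η) :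
    ∃ γ, IsCouplingMeasure γ μ ν ∧ γ {p | s p.1 ≠ t p.2} ≤ Fintype.card L * η := by
  classical
  set a : L → ℝ≥0∞ := fun l => μ (s ⁻¹' {l}) with ha
  set b : L → ℝ≥0∞ := fun l => ν (t ⁻¹' {l}) with hb
  have hPm : ∀ l, MeasurableSet (s ⁻¹' {l}) := fun l => hs (measurableSet_singleton l)
  have hQm : ∀ l, MeasurableSet (t ⁻¹' {l}) := fun l => ht (measurableSet_singleton l)
  set I : Finset L := Finset.univ.erase o with hI
  have hIo : ∀ l ∈ I, l ≠ o := fun l hl => Finset.ne_of_mem_erase hl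
  -- The fraction of class `l` in `X` that can be matched with class `l` in `Y`. An empty class has
  -- `b l = 0` as well, so the fraction is 0 there.
  set r : L → ℝ≥0∞ := fun l => (a l)⁻¹ * b l with hr
  have hr1 : ∀ l ∈ I, r l ≤ 1 := fun l hl => by
    have : r l = b l / a l := mul_comm _ _
    rw [this]
    exact (ENNReal.div_le_div_right (hle l (hIo l hl)) _).trans ENNReal.div_self_le_one
  have hra : ∀ l ∈ I, r l * a l = b l := fun l hl => by
    by_cases h0 : a l = 0
    · have : b l = 0 := le_antisymm ((hle l (hIo l hl)).trans h0.le) bot_le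
      rw [h0, this, mul_zero]
    · rw [mul_comm, ← mul_assoc (a l), ENNReal.mul_inv_cancel h0 (hfin l (hIo l hl)), one_mul]
  -- What remains after the matching: on the `X` side, class `o` and the unmatched fractions; on the
  -- `Y` side, class `o` alone. Both are infinite, so they can be coupled arbitrarily.
  set μ' : Measure X := μ.restrict (s ⁻¹' {o}) + ∑ l ∈ I, (1 - r l) • μ.restrict (s ⁻¹' {l})
    with hμ'
  set ν' : Measure Y := ν.restrict (t ⁻¹' {o}) with hν'
  have hsum : ∀ J : Finset L, SFinite (∑ l ∈ J, (1 - r l) • μ.restrict (s ⁻¹' {l})) := fun J => by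
    induction J using Finset.induction_on with
    | empty => rw [Finset.sum_empty]; infer_instance
    | insert l J hl ih => rw [Finset.sum_insert hl]; infer_instance
  have := hsum I
  have : SFinite μ' := by rw [hμ']; infer_instance
  obtain ⟨γ', hγ'⟩ := exists_isCouplingMeasure μ' ν'
    (by rw [hμ', Measure.add_apply, Measure.restrict_apply_univ, hμo, top_add])
    (by rw [hν', Measure.restrict_apply_univ, hνo])
  refine ⟨γ' + ∑ l ∈ I, (a l)⁻¹ • (μ.restrict (s ⁻¹' {l})).prod (ν.restrict (t ⁻¹' {l})),
    ⟨?_, ?_⟩, ?_⟩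
  · rw [Measure.map_add _ _ measurable_fst, hγ'.1, ← Measure.mapₗ_apply_of_measurable measurable_fst,
      map_sum]
    simp only [Measure.mapₗ_apply_of_measurable measurable_fst, Measure.map_smul,
      Measure.map_fst_prod, Measure.restrict_apply_univ, smul_smul]
    conv_rhs => rw [← restrict_add_sum_erase μ hs o]
    rw [hμ', add_assoc, ← Finset.sum_add_distrib]
    congr 1
    refine Finset.sum_congr rfl fun l hl => ?_
    rw [← add_smul]
    change (1 - r l + r l) • _ = _
    rw [tsub_add_cancel_of_le (hr1 l hl), one_smul]
  · rw [Measure.map_add _ _ measurable_snd, hγ'.2, ← Measure.mapₗ_apply_of_measurable measurable_snd,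
      map_sum]
    simp only [Measure.mapₗ_apply_of_measurable measurable_snd, Measure.map_smul,
      Measure.map_snd_prod, Measure.restrict_apply_univ, smul_smul]
    conv_rhs => rw [← restrict_add_sum_erase ν ht o]
    congr 1
    refine Finset.sum_congr rfl fun l hl => ?_
    by_cases h0 : a l = 0
    · have : ν.restrict (t ⁻¹' {l}) = 0 :=
        Measure.restrict_eq_zero.2 (le_antisymm ((hle l (hIo l hl)).trans h0.le) bot_le)
      rw [this, smul_zero]
    · change ((a l)⁻¹ * a l) • _ = _
      rw [ENNReal.inv_mul_cancel h0 (hfin l (hIo l hl)), one_smul]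
  · have hsub : ∀ l : L, {p : X × Y | s p.1 ≠ t p.2}
        ⊆ Prod.fst ⁻¹' (s ⁻¹' {l})ᶜ ∪ Prod.snd ⁻¹' (t ⁻¹' {l})ᶜ := by
      intro l p hp
      by_contra h
      simp only [mem_union, mem_preimage, mem_compl_iff, mem_singleton_iff, not_or, not_not] at h
      exact hp (h.1.trans h.2.symm)
    -- Every second coordinate under `γ'` has label `o` almost surely, so a mismatch needs a first
    -- coordinate from the unmatched excess, of mass at most `η` per class.
    have h1 : γ' {p | s p.1 ≠ t p.2} ≤ Fintype.card L * η := by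
      calc γ' {p | s p.1 ≠ t p.2}
          ≤ γ' (Prod.fst ⁻¹' (s ⁻¹' {o})ᶜ) + γ' (Prod.snd ⁻¹' (t ⁻¹' {o})ᶜ) :=
            (measure_mono (hsub o)).trans (measure_union_le _ _)
        _ = μ' (s ⁻¹' {o})ᶜ + ν' (t ⁻¹' {o})ᶜ := by
            rw [← Measure.map_apply measurable_fst (hPm o).compl,
              ← Measure.map_apply measurable_snd (hQm o).compl, hγ'.1, hγ'.2]
        _ ≤ ∑ l ∈ I, (1 - r l) * a l := by
            rw [hμ', hν', Measure.add_apply, Measure.restrict_apply (hQm o).compl,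
              Measure.restrict_apply (hPm o).compl, compl_inter_self, compl_inter_self,
              measure_empty, measure_empty, zero_add, add_zero, Measure.finsetSum_apply]
            refine Finset.sum_le_sum fun l _ => ?_
            rw [Measure.smul_apply, smul_eq_mul]
            refine mul_le_mul_right ?_ _
            rw [Measure.restrict_apply (hPm o).compl]
            exact measure_mono inter_subset_right
        _ ≤ ∑ _l ∈ I, η := by
            refine Finset.sum_le_sum fun l hl => ?_
            rw [ENNReal.sub_mul fun _ _ => hfin l (hIo l hl), one_mul, hra l hl]
            exact tsub_le_iff_left.2 (hη l (hIo l hl))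
        _ ≤ Fintype.card L * η := by
            rw [Finset.sum_const, nsmul_eq_mul]
            gcongr
            exact Finset.card_le_univ I
    have h2 : ∀ l, ((μ.restrict (s ⁻¹' {l})).prod (ν.restrict (t ⁻¹' {l})))
        {p | s p.1 ≠ t p.2} = 0 := fun l => by
      refine measure_mono_null (hsub l) (measure_union_null ?_ ?_)
      · rw [← prod_univ, Measure.prod_prod, Measure.restrict_apply (hPm l).compl, compl_inter_self,
          measure_empty, zero_mul]
      · rw [← univ_prod, Measure.prod_prod, Measure.restrict_apply (hQm l).compl, compl_inter_self,
          measure_empty, mul_zero]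
    rw [Measure.add_apply, Measure.finsetSum_apply,
      Finset.sum_eq_zero fun l _ => by rw [Measure.smul_apply, h2, smul_zero], add_zero]
    exact h1

/-- Step functions given by the same matrix and by labellings that mostly agree are close in `L¹`. -/
theorem lintegral_matrix_sub_le {Z : Type*} [MeasurableSpace Z] {γ : Measure Z} [SigmaFinite γ]
    {s t : Z → L} (hs : Measurable s) (ht : Measurable t) {o : L} {m : L × L → ℝ} {C : ℝ≥0}
    (hm : ∀ p, |m p| ≤ C) (hm₁ : ∀ l, m (o, l) = 0) (hm₂ : ∀ l, m (l, o) = 0) {κ M : ℝ≥0∞}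
    (hκ : γ {z | s z ≠ t z} ≤ κ) (hsM : γ {z | s z ≠ o} ≤ M) (htM : γ {z | t z ≠ o} ≤ M) :
    ∫⁻ p, ‖(pullback s m - pullback t m) p‖ₑ ∂(γ.prod γ) ≤ 8 * C * κ * M := by
  set E : Set Z := {z | s z ≠ t z} with hE
  set N : Set Z := {z | s z ≠ o} ∪ {z | t z ≠ o} with hN
  have hEm : MeasurableSet E := (measurableSet_eq_fun hs ht).compl
  have hNm : MeasurableSet N :=
    (hs (measurableSet_singleton o)).compl.union (ht (measurableSet_singleton o)).compl
  have hNM : γ N ≤ 2 * M := (measure_union_le _ _).trans ((add_le_add hsM htM).trans_eq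
    (two_mul M).symm)
  -- A nonzero difference needs a mislabelled point in one coordinate and, in the other, a point at
  -- which some label differs from `o`, since the row and column of `o` vanish.
  have hpt : ∀ p : Z × Z, ‖(pullback s m - pullback t m) p‖ₑ
      ≤ (E ×ˢ N).indicator (fun _ => (2 * C : ℝ≥0∞)) p
        + (N ×ˢ E).indicator (fun _ => (2 * C : ℝ≥0∞)) p := by
    rintro ⟨x, y⟩
    have hb : ‖(pullback s m - pullback t m) (x, y)‖ₑ ≤ 2 * C := by
      have : ‖(pullback s m - pullback t m) (x, y)‖ ≤ (2 * C : ℝ≥0) := by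
        refine (norm_sub_le _ _).trans ?_
        push_cast
        have h1 := hm (s x, s y)
        have h2 := hm (t x, t y)
        simp only [pullback, Real.norm_eq_abs]
        linarith
      have h3 : ‖(pullback s m - pullback t m) (x, y)‖ₑ ≤ ((2 * C : ℝ≥0) : ℝ≥0∞) :=
        ENNReal.coe_le_coe.2 this
      simpa using h3
    by_cases h1 : (x, y) ∈ E ×ˢ N
    · rw [indicator_of_mem h1]
      exact hb.trans le_self_add
    by_cases h2 : (x, y) ∈ N ×ˢ E
    · rw [indicator_of_mem h2]
      exact hb.trans le_add_self
    have h0 : (pullback s m - pullback t m) (x, y) = 0 := by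
      simp only [mem_prod, not_and] at h1 h2
      simp only [Pi.sub_apply, pullback]
      by_cases hx : x ∈ E
      · have hy := h1 hx
        simp only [hN, mem_union, mem_ofPred_eq, not_or, not_not] at hy
        rw [hy.1, hy.2, hm₂, hm₂, sub_zero]
      · by_cases hy : y ∈ E
        · have hx' : x ∉ N := fun h => h2 h hy
          simp only [hN, mem_union, mem_ofPred_eq, not_or, not_not] at hx'
          rw [hx'.1, hx'.2, hm₁, hm₁, sub_zero]
        · simp only [hE, mem_ofPred_eq, not_not] at hx hy
          rw [hx, hy, sub_self]
    rw [h0, enorm_zero]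
    exact bot_le
  calc ∫⁻ p, ‖(pullback s m - pullback t m) p‖ₑ ∂(γ.prod γ)
      ≤ ∫⁻ p, ((E ×ˢ N).indicator (fun _ => (2 * C : ℝ≥0∞)) p
        + (N ×ˢ E).indicator (fun _ => (2 * C : ℝ≥0∞)) p) ∂(γ.prod γ) := lintegral_mono hpt
    _ = 2 * C * (γ E * γ N) + 2 * C * (γ N * γ E) := by
        rw [lintegral_add_left (measurable_const.indicator (hEm.prod hNm)),
          lintegral_indicator_const (hEm.prod hNm), lintegral_indicator_const (hNm.prod hEm),
          Measure.prod_prod, Measure.prod_prod]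
    _ ≤ 2 * C * (κ * (2 * M)) + 2 * C * (2 * M * κ) := by gcongr
    _ = 8 * C * κ * M := by ring

end Labels

/-! ### Weak regularity with a finite list of matrices. -/

section WeakRegularity

theorem cutNorm_symmetrize_le {S : Type*} [MeasurableSpace S] {μ : Measure S} [SFinite μ]
    {F : S × S → ℝ} (hF : Integrable F (μ.prod μ)) :
    cutNorm μ (fun p => (F p + F p.swap) / 2) ≤ cutNorm μ F := by
  by_cases htop : cutNorm μ F = ∞
  · rw [htop]; exact le_top
  refine cutNorm_le fun T U hT hU => ?_
  have hadd : ∫ p in T ×ˢ U, (F p + F p.swap) ∂(μ.prod μ)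
      = (∫ p in T ×ˢ U, F p ∂(μ.prod μ)) + ∫ p in T ×ˢ U, F p.swap ∂(μ.prod μ) :=
    integral_add hF.integrableOn hF.swap.integrableOn
  rw [integral_div, hadd]
  have hsw : ∫ p in T ×ˢ U, F p.swap ∂(μ.prod μ) = ∫ p in U ×ˢ T, F p ∂(μ.prod μ) :=
    setIntegral_prod_swap _ _ _
  have hc : cutNorm μ F ≤ ENNReal.ofReal (cutNorm μ F).toReal := (ENNReal.ofReal_toReal htop).symm.le
  have h1 := abs_setIntegral_le_of_cutNorm_le ENNReal.toReal_nonneg hc hT hU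
  have h2 := abs_setIntegral_le_of_cutNorm_le ENNReal.toReal_nonneg hc hU hT
  refine ENNReal.ofReal_le_of_le_toReal ?_
  rw [hsw]
  rw [abs_le] at *
  constructor <;> linarith [h1.1, h1.2, h2.1, h2.2]

/-- A sum of signed indicator functions of rectangles, with a common absolute value `c` of the
coefficients. -/
noncomputable def rectSum {S : Type*} (c : ℝ) {n : ℕ} (σ : Fin n → Bool) (s t : Fin n → Set S) :
    S × S → ℝ :=
  fun p => ∑ l, (s l ×ˢ t l).indicator (fun _ => if σ l then c else -c) p

theorem integrable_rectSum {S : Type*} [MeasurableSpace S] {μ : Measure S} [IsFiniteMeasure μ]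
    (c : ℝ) {n : ℕ} (σ : Fin n → Bool) {s t : Fin n → Set S} (hs : ∀ l, MeasurableSet (s l))
    (ht : ∀ l, MeasurableSet (t l)) : Integrable (rectSum c σ s t) (μ.prod μ) :=
  integrable_finsetSum _ fun l _ => (integrable_const _).indicator ((hs l).prod (ht l))

/-- Subtracting a suitable multiple of the indicator function of a rectangle with large integral
decreases the `L²` norm. -/
theorem integral_sq_sub_indicator_le {S : Type*} [MeasurableSpace S] {μ : Measure S}
    [IsFiniteMeasure μ] {M ε : ℝ} (hM : 0 < M) (hμ : μ.real univ ≤ M) (hε : 0 < ε)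
    {R : S × S → ℝ} (hR : Integrable R (μ.prod μ)) (hR2 : Integrable (fun p => R p ^ 2) (μ.prod μ))
    {T U : Set S} (hT : MeasurableSet T) (hU : MeasurableSet U) {d : ℝ}
    (hd : |d| = ε / M ^ 2) (hdR : |d| * ε ≤ d * ∫ p in T ×ˢ U, R p ∂(μ.prod μ)) :
    Integrable (fun p => (R - (T ×ˢ U).indicator fun _ => d) p ^ 2) (μ.prod μ) ∧
      ∫ p, (R - (T ×ˢ U).indicator fun _ => d) p ^ 2 ∂(μ.prod μ)
        ≤ ∫ p, R p ^ 2 ∂(μ.prod μ) - ε ^ 2 / M ^ 2 := by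
  have hTU := hT.prod hU
  -- Expanding the square, the quadratic term adds at most `ε² / M²` and the cross term removes at
  -- least twice that.
  have e : (fun p => (R - (T ×ˢ U).indicator fun _ => d) p ^ 2)
      = fun p => R p ^ 2 + (T ×ˢ U).indicator (fun p => d ^ 2 - 2 * d * R p) p := by
    funext p
    by_cases hp : p ∈ T ×ˢ U
    · simp only [Pi.sub_apply, indicator_of_mem hp]; ring
    · simp only [Pi.sub_apply, indicator_of_notMem hp]; ring
  have hi : Integrable (fun p => d ^ 2 - 2 * d * R p) (μ.prod μ) :=
    (integrable_const _).sub (hR.const_mul _)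
  rw [e]
  refine ⟨hR2.add (hi.indicator hTU), ?_⟩
  rw [integral_add hR2 (hi.indicator hTU), integral_indicator hTU,
    integral_sub (integrable_const _) (hR.const_mul _).integrableOn, integral_const_mul,
    setIntegral_const, smul_eq_mul]
  have hvol : (μ.prod μ).real (T ×ˢ U) ≤ M ^ 2 := by
    rw [measureReal_prod_prod, sq]
    exact mul_le_mul ((measureReal_mono (subset_univ _)).trans hμ)
      ((measureReal_mono (subset_univ _)).trans hμ) measureReal_nonneg hM.le
  have h1 : (μ.prod μ).real (T ×ˢ U) * d ^ 2 ≤ ε ^ 2 / M ^ 2 := by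
    calc (μ.prod μ).real (T ×ˢ U) * d ^ 2 ≤ M ^ 2 * d ^ 2 := by gcongr
      _ = ε ^ 2 / M ^ 2 := by
        rw [← sq_abs d, hd]
        field_simp
  have h2 : |d| * ε = ε ^ 2 / M ^ 2 := by
    rw [hd]
    ring
  linarith

/-- The weak regularity lemma: a function is close in cut norm to a signed combination of indicator
functions of rectangles, whose number is bounded in terms of the `L²` norm. -/
theorem exists_cutNorm_sub_rectSum_le {S : Type*} [MeasurableSpace S] {μ : Measure S}
    [IsFiniteMeasure μ] {M ε : ℝ} (hM : 0 < M) (hμ : μ.real univ ≤ M) (hε : 0 < ε) (n : ℕ) :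
    ∀ {R : S × S → ℝ}, Integrable R (μ.prod μ) → Integrable (fun p => R p ^ 2) (μ.prod μ) →
      ∫ p, R p ^ 2 ∂(μ.prod μ) ≤ n * (ε ^ 2 / M ^ 2) →
      ∃ (σ : Fin n → Bool) (s t : Fin n → Set S), (∀ l, MeasurableSet (s l)) ∧
        (∀ l, MeasurableSet (t l)) ∧
        cutNorm μ (R - rectSum (ε / M ^ 2) σ s t) ≤ ENNReal.ofReal ε := by
  have hc : 0 < ε / M ^ 2 := by positivity
  induction n with
  | zero =>
    intro R hR hR2 hle
    refine ⟨fun _ => true, fun _ => ∅, fun _ => ∅, fun _ => .empty, fun _ => .empty, ?_⟩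
    have h0 : (fun p => R p ^ 2) =ᵐ[μ.prod μ] 0 := by
      rw [← integral_eq_zero_iff_of_nonneg (fun p => sq_nonneg _) hR2]
      exact le_antisymm (by simpa using hle) (integral_nonneg fun p => sq_nonneg _)
    have h1 : (R - rectSum (ε / M ^ 2) (fun _ : Fin 0 => true) (fun _ => ∅) fun _ => ∅)
        =ᵐ[μ.prod μ] fun _ => 0 := by
      filter_upwards [h0] with p hp
      simpa [rectSum] using hp
    rw [cutNorm_congr_ae h1]
    exact cutNorm_le fun T U _ _ => by simp
  | succ n ih =>
    intro R hR hR2 hle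
    by_cases hcut : cutNorm μ R ≤ ENNReal.ofReal ε
    -- If the remainder is already small, the list is padded with empty rectangles, so that its
    -- length depends only on the energy bound.
    · refine ⟨fun _ => true, fun _ => ∅, fun _ => ∅, fun _ => .empty, fun _ => .empty, ?_⟩
      have : R - rectSum (ε / M ^ 2) (fun _ : Fin (n + 1) => true) (fun _ => ∅) (fun _ => ∅)
          = R := by
        funext p; simp [rectSum]
      rwa [this]
    · have : ∃ T U : Set S, MeasurableSet T ∧ MeasurableSet U ∧
          ε < |∫ p in T ×ˢ U, R p ∂(μ.prod μ)| := by
        by_contra! h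
        exact hcut (cutNorm_le fun T U hT hU => ENNReal.ofReal_le_ofReal (h T U hT hU))
      obtain ⟨T, U, hT, hU, hTU⟩ := this
      obtain ⟨σ₀, hσ₀⟩ : ∃ σ₀ : Bool, (ε / M ^ 2) * ε
          ≤ (if σ₀ then ε / M ^ 2 else -(ε / M ^ 2)) * ∫ p in T ×ˢ U, R p ∂(μ.prod μ) := by
        rcases le_abs'.1 hTU.le with h | h
        · refine ⟨false, ?_⟩
          simp only [Bool.false_eq_true, if_false]
          nlinarith
        · refine ⟨true, ?_⟩
          simp only [if_true]
          nlinarith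
      set d : ℝ := if σ₀ then ε / M ^ 2 else -(ε / M ^ 2) with hd
      have hdabs : |d| = ε / M ^ 2 := by
        cases σ₀
        · simp only [hd, Bool.false_eq_true, if_false, abs_neg, abs_of_pos hc]
        · simp only [hd, if_true, abs_of_pos hc]
      obtain ⟨hi, hle'⟩ := integral_sq_sub_indicator_le hM hμ hε hR hR2 hT hU hdabs
        (by rw [hdabs]; exact hσ₀)
      obtain ⟨σ, s, t, hs, ht, hcut'⟩ := ih
        (hR.sub ((integrable_const d).indicator (hT.prod hU))) hi (by
          push_cast at hle
          linarith)
      refine ⟨Fin.cons σ₀ σ, Fin.cons T s, Fin.cons U t, Fin.cases hT hs, Fin.cases hU ht, ?_⟩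
      convert hcut' using 2
      funext p
      simp only [Pi.sub_apply, rectSum, Fin.sum_univ_succ, Fin.cons_zero, Fin.cons_succ]
      rw [sub_add_eq_sub_sub]

/-- The symmetric matrix, indexed by the membership patterns of points in `n` pairs of sets, that
belongs to a symmetrised sum of signed indicator functions of rectangles. -/
noncomputable def patternMatrix (c : ℝ) {n : ℕ} (σ : Fin n → Bool)
    (p : (Fin n → Bool × Bool) × (Fin n → Bool × Bool)) : ℝ :=
  ∑ l, (if σ l then c else -c)
    * (((if (p.1 l).1 && (p.2 l).2 then 1 else 0) + if (p.1 l).2 && (p.2 l).1 then 1 else 0) / 2)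

theorem patternMatrix_symm (c : ℝ) {n : ℕ} (σ : Fin n → Bool) (x y : Fin n → Bool × Bool) :
    patternMatrix c σ (x, y) = patternMatrix c σ (y, x) := by
  simp only [patternMatrix]
  refine Finset.sum_congr rfl fun l _ => ?_
  rw [add_comm]
  simp only [Bool.and_comm]

theorem patternMatrix_zero_left (c : ℝ) {n : ℕ} (σ : Fin n → Bool) (y : Fin n → Bool × Bool) :
    patternMatrix c σ (fun _ => (false, false), y) = 0 := by
  simp [patternMatrix]

theorem abs_patternMatrix_le (c : ℝ≥0) {n : ℕ} (σ : Fin n → Bool)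
    (p : (Fin n → Bool × Bool) × (Fin n → Bool × Bool)) :
    |patternMatrix c σ p| ≤ (n * c : ℝ≥0) := by
  refine (Finset.abs_sum_le_sum_abs _ _).trans ?_
  have : ∀ l ∈ Finset.univ, |(if σ l then (c : ℝ) else -c)
      * (((if (p.1 l).1 && (p.2 l).2 then 1 else 0) + if (p.1 l).2 && (p.2 l).1 then 1 else 0) / 2)|
      ≤ c := fun l _ => by
    rw [abs_mul]
    have h1 : |(if σ l then (c : ℝ) else -c)| = c := by split_ifs <;> simp
    rw [h1]
    refine mul_le_of_le_one_right c.2 ?_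
    split_ifs <;> norm_num
  refine (Finset.sum_le_sum this).trans_eq ?_
  simp

theorem measurable_decide_mem {S : Type*} [MeasurableSpace S] {s : Set S} [DecidablePred (· ∈ s)]
    (hs : MeasurableSet s) : Measurable fun x => decide (x ∈ s) := by
  refine measurable_to_bool ?_
  have : (fun x => decide (x ∈ s)) ⁻¹' {true} = s := by ext x; simp
  rwa [this]

/-- Bounded graphons that vanish outside the square of a set of bounded measure are uniformly close
in cut norm to step graphons from a finite list. -/
theorem exists_cutNorm_sub_pullback_patternMatrix_le (M B : ℝ≥0) {ε : ℝ} (hε : 0 < ε) :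
    ∃ (n : ℕ) (c : ℝ≥0), ∀ {S : Type*} [MeasurableSpace S] {μ : Measure S} [SigmaFinite μ]
      {U : Set S} {V : S × S → ℝ}, MeasurableSet U → μ U ≤ M → IsGraphon μ V →
      (∀ p, |V p| ≤ (U ×ˢ U).indicator (fun _ => (B : ℝ)) p) →
      ∃ (σ : Fin n → Bool) (τ : S → Fin n → Bool × Bool), Measurable τ ∧
        (∀ x ∉ U, τ x = fun _ => (false, false)) ∧
        cutNorm μ (V - pullback τ (patternMatrix c σ)) ≤ ENNReal.ofReal ε := by
  classical
  set M' : ℝ := M + 1 with hM'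
  have hM0 : 0 < M' := by positivity
  -- The energy of V is at most `B² M'²`, and each rectangle removes `ε² / M'²`.
  obtain ⟨n, hn⟩ := exists_nat_ge ((B : ℝ) ^ 2 * M' ^ 2 / (ε ^ 2 / M' ^ 2))
  refine ⟨n, ⟨ε / M' ^ 2, by positivity⟩, ?_⟩
  intro S _ μ _ U V hU hM hV hb
  have hfin : IsFiniteMeasure (μ.restrict U) :=
    ⟨by rw [Measure.restrict_apply_univ]; exact hM.trans_lt ENNReal.coe_lt_top⟩
  have hreal : (μ.restrict U).real univ ≤ M' := by
    rw [measureReal_restrict_apply_univ]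
    have : μ.real U ≤ M := ENNReal.toReal_le_coe_of_le_coe hM
    linarith
  have hbB : ∀ p, |V p| ≤ B := fun p => (hb p).trans (indicator_le_self' (fun _ _ => B.2) _)
  have hVi : Integrable V ((μ.restrict U).prod (μ.restrict U)) := by
    rw [Measure.prod_restrict]
    exact hV.integrable.integrableOn
  have hsqle : ∀ p, V p ^ 2 ≤ (B : ℝ) ^ 2 := fun p => sq_le_sq.2 (by
    exact (hbB p).trans (le_abs_self _))
  have hV2 : Integrable (fun p => V p ^ 2) ((μ.restrict U).prod (μ.restrict U)) :=
    (integrable_const ((B : ℝ) ^ 2)).mono' (hVi.1.pow 2) (Filter.Eventually.of_forall fun p => by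
      rw [Real.norm_of_nonneg (sq_nonneg _)]
      exact hsqle p)
  have hen : ∫ p, V p ^ 2 ∂((μ.restrict U).prod (μ.restrict U)) ≤ n * (ε ^ 2 / M' ^ 2) := by
    calc ∫ p, V p ^ 2 ∂((μ.restrict U).prod (μ.restrict U))
        ≤ ∫ _p, (B : ℝ) ^ 2 ∂((μ.restrict U).prod (μ.restrict U)) :=
          integral_mono hV2 (integrable_const _) hsqle
      _ = (μ.restrict U).real univ * (μ.restrict U).real univ * (B : ℝ) ^ 2 := by
          rw [integral_const, smul_eq_mul, ← univ_prod_univ, measureReal_prod_prod]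
      _ ≤ M' * M' * (B : ℝ) ^ 2 := by gcongr
      _ = (B : ℝ) ^ 2 * M' ^ 2 := by ring
      _ ≤ n * (ε ^ 2 / M' ^ 2) := (div_le_iff₀ (by positivity)).1 hn
  obtain ⟨σ, s, t, hs, ht, hcut⟩ := exists_cutNorm_sub_rectSum_le hM0 hreal hε n hVi hV2 hen
  -- Intersecting with `U` gives every point outside `U` the all-false pattern, whose matrix row is
  -- zero.
  refine ⟨σ, fun x l => (decide (x ∈ U ∩ s l), decide (x ∈ U ∩ t l)), ?_, fun x hx => ?_, ?_⟩
  · refine measurable_pi_iff.2 fun l => Measurable.prodMk ?_ ?_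
    · exact measurable_decide_mem (hU.inter (hs l))
    · exact measurable_decide_mem (hU.inter (ht l))
  · funext l
    simp [hx]
  · set F := V - rectSum (ε / M' ^ 2) σ s t with hF
    have hFi : Integrable F ((μ.restrict U).prod (μ.restrict U)) :=
      hVi.sub (integrable_rectSum _ _ hs ht)
    -- As V is symmetric, symmetrising the error symmetrises only the sum of rectangles, and that is
    -- exactly the pattern matrix.
    refine le_trans (le_of_eq ?_) ((cutNorm_symmetrize_le hFi).trans hcut)
    rw [← cutNorm_indicator_eq_restrict hU]
    congr 1
    funext p
    by_cases hp : p ∈ U ×ˢ U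
    · rw [indicator_of_mem hp]
      have hsw : V p.swap = V p := hV.symm _ _
      have e1 : pullback (fun x l => (decide (x ∈ U ∩ s l), decide (x ∈ U ∩ t l)))
          (patternMatrix (ε / M' ^ 2) σ) p
          = (rectSum (ε / M' ^ 2) σ s t p + rectSum (ε / M' ^ 2) σ s t p.swap) / 2 := by
        simp only [pullback, patternMatrix, rectSum]
        rw [← Finset.sum_add_distrib, Finset.sum_div]
        refine Finset.sum_congr rfl fun l _ => ?_
        simp only [indicator_apply, mem_prod, mem_inter_iff, hp.1, hp.2, true_and,
          Bool.and_eq_true, decide_eq_true_eq, Prod.fst_swap, Prod.snd_swap]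
        simp only [and_comm (a := p.2 ∈ s l)]
        split_ifs <;> ring
      change V p - pullback (fun x l => (decide (x ∈ U ∩ s l), decide (x ∈ U ∩ t l)))
          (patternMatrix (ε / M' ^ 2) σ) p = _
      rw [e1]
      simp only [hF, Pi.sub_apply, hsw]
      ring
    · rw [indicator_of_notMem hp]
      have h0 : V p = 0 := eq_zero_of_abs_le_indicator hb hp
      have e1 : pullback (fun x l => (decide (x ∈ U ∩ s l), decide (x ∈ U ∩ t l)))
          (patternMatrix (ε / M' ^ 2) σ) p = 0 := by
        simp only [mem_prod, not_and] at hp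
        simp only [pullback, patternMatrix]
        refine Finset.sum_eq_zero fun l _ => ?_
        by_cases h1 : p.1 ∈ U
        · simp [hp h1]
        · simp [h1]
      change V p - pullback (fun x l => (decide (x ∈ U ∩ s l), decide (x ∈ U ∩ t l)))
          (patternMatrix (ε / M' ^ 2) σ) p = _
      rw [h0, e1, sub_zero]

end WeakRegularity

/-! ### Step graphons and finite weighted graphons in the cut metric. -/

theorem extMeasure_preimage_sumElim {S L : Type*} [MeasurableSpace S] [MeasurableSpace L]
    (μ : Measure S) {τ : S → L}
    (hτ : Measurable τ) {o : L} {E : Set L} (hE : MeasurableSet E) (ho : o ∉ E) :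
    extMeasure μ (Sum.elim τ (fun _ => o) ⁻¹' E) = μ (τ ⁻¹' E) := by
  have hm : Measurable (Sum.elim τ fun _ : ℝ => o) := hτ.sumElim measurable_const
  have h1 : (Sum.inl : S → S ⊕ ℝ) ⁻¹' (Sum.elim τ (fun _ => o) ⁻¹' E) = τ ⁻¹' E := rfl
  have h2 : (Sum.inr : ℝ → S ⊕ ℝ) ⁻¹' (Sum.elim τ (fun _ => o) ⁻¹' E) = ∅ := by
    ext x; simp [ho]
  rw [extMeasure_apply (hm hE), h1, h2, measure_empty, add_zero]

theorem extMeasure_preimage_sumElim_singleton {S L : Type*} [MeasurableSpace S] [MeasurableSpace L]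
    [MeasurableSingletonClass L] (μ : Measure S) {τ : S → L} (hτ : Measurable τ) (o : L) :
    extMeasure μ (Sum.elim τ (fun _ => o) ⁻¹' {o}) = ∞ := by
  have hm : Measurable (Sum.elim τ fun _ : ℝ => o) := hτ.sumElim measurable_const
  have h2 : (Sum.inr : ℝ → S ⊕ ℝ) ⁻¹' (Sum.elim τ (fun _ => o) ⁻¹' {o}) = univ := by
    ext x; simp
  rw [extMeasure_apply (hm (measurableSet_singleton o)), h2, Real.volume_univ, add_top]

theorem extFun_pullback_matrix {S L : Type*} (τ : S → L) {o : L} {m : L × L → ℝ}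
    (hm : ∀ x y, m (x, y) = m (y, x)) (hm₀ : ∀ l, m (o, l) = 0) :
    extFun (pullback τ m) = pullback (Sum.elim τ fun _ => o) m := by
  funext p
  rcases p with ⟨x | x, y | y⟩ <;> simp [extFun, pullback, hm₀, hm _ o]

theorem couplingDist_trivialExtension_le (W₁ W₂ : Graphon.{u})
    {γ : Measure ((W₁.S ⊕ ℝ) × (W₂.S ⊕ ℝ))}
    (hγ : IsCouplingMeasure γ (extMeasure W₁.μ) (extMeasure W₂.μ)) :
    couplingDist W₁.trivialExtension W₂.trivialExtension
      ≤ cutNorm γ (pullback Prod.fst (extFun W₁.W) - pullback Prod.snd (extFun W₂.W) :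
        ((W₁.S ⊕ ℝ) × (W₂.S ⊕ ℝ)) × ((W₁.S ⊕ ℝ) × (W₂.S ⊕ ℝ)) → ℝ) :=
  iInf₂_le γ hγ

theorem measurableSingletonClass_uLift {L : Type*} [MeasurableSpace L]
    [MeasurableSingletonClass L] : MeasurableSingletonClass (ULift.{u} L) :=
  ⟨fun x => by
    have : {x} = ULift.down ⁻¹' {x.down} := by
      ext y
      exact ⟨fun h => congrArg ULift.down h, fun h => ULift.ext _ _ h⟩
    rw [this]
    exact measurable_down (measurableSet_singleton _)⟩

section WeightedGraphon

variable {L : Type} [Fintype L] [MeasurableSpace L] [MeasurableSingletonClass L]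

/-- The measure on a finite set given by point masses. -/
noncomputable def weightedMeasure (b : L → ℝ≥0) : Measure (ULift.{u} L) :=
  ∑ l, (b l : ℝ≥0∞) • Measure.dirac (ULift.up l)

theorem weightedMeasure_apply (b : L → ℝ≥0) (E : Set (ULift.{u} L)) [DecidablePred (· ∈ E)] :
    weightedMeasure b E = ∑ l, if ULift.up l ∈ E then (b l : ℝ≥0∞) else 0 := by
  have := measurableSingletonClass_uLift.{u} (L := L)
  rw [weightedMeasure, Measure.finsetSum_apply]
  refine Finset.sum_congr rfl fun l _ => ?_
  rw [Measure.smul_apply, smul_eq_mul, Measure.dirac_apply, indicator_apply]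
  split_ifs <;> simp

theorem isFiniteMeasure_weightedMeasure (b : L → ℝ≥0) :
    IsFiniteMeasure (weightedMeasure.{u} b) := by
  classical
  refine ⟨?_⟩
  rw [weightedMeasure_apply]
  simp

/-- The graphon on a finite set with given point masses and a given symmetric matrix. -/
noncomputable def weightedGraphon (b : L → ℝ≥0) (m : L × L → ℝ)
    (hm : ∀ x y, m (x, y) = m (y, x)) : Graphon.{u} :=
  haveI := isFiniteMeasure_weightedMeasure.{u} b
  { S := ULift.{u} L
    μ := weightedMeasure b
    W := pullback ULift.down m
    isGraphon := ⟨fun _ _ => hm _ _, by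
      have := measurableSingletonClass_uLift.{u} (L := L)
      exact Integrable.of_finite⟩ }

theorem isGraphon_pullback_matrix {S : Type*} [MeasurableSpace S] {μ : Measure S} [SigmaFinite μ]
    {τ : S → L} (hτ : Measurable τ) {o : L} (hfin : μ {x | τ x ≠ o} ≠ ∞) {m : L × L → ℝ} {C : ℝ}
    (hm : ∀ x y, m (x, y) = m (y, x)) (hC : ∀ p, |m p| ≤ C) (hm₀ : ∀ l, m (o, l) = 0) :
    IsGraphon μ (pullback τ m) := by
  refine ⟨fun _ _ => hm _ _, ?_⟩
  have hN : MeasurableSet {x | τ x ≠ o} := (hτ (measurableSet_singleton o)).compl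
  have e : ({x | τ x ≠ o} ×ˢ {x | τ x ≠ o}).indicator (pullback τ m) = pullback τ m := by
    refine indicator_eq_self.2 fun p hp => ?_
    by_contra h
    simp only [mem_prod, mem_ofPred_eq, not_and_or, not_not] at h
    refine hp ?_
    rcases h with h | h
    · simp only [pullback, h, hm₀]
    · change m (τ p.1, τ p.2) = 0
      rw [h, hm, hm₀]
  have hmm : Measurable (pullback τ m) :=
    (measurable_of_finite m).comp ((hτ.comp measurable_fst).prodMk (hτ.comp measurable_snd))
  rw [← e, integrable_indicator_iff (hN.prod hN)]
  refine Measure.integrableOn_of_bounded (M := C) ?_ hmm.aestronglyMeasurable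
    (Filter.Eventually.of_forall fun p => hC _)
  rw [Measure.prod_prod]
  exact ENNReal.mul_ne_top hfin hfin

/-- A graphon that is close in cut norm to a step graphon has a coupling, after trivial extensions, in
which it is close to a step graphon with the same matrix and almost the same masses. -/
theorem exists_isCouplingMeasure_extFun_cutNorm_le {X Y : Type*} [MeasurableSpace X]
    [MeasurableSpace Y] {μ : Measure X} {ν : Measure Y} [SigmaFinite μ] [SigmaFinite ν]
    {W : X × X → ℝ} (hW : IsGraphon μ W) {τ : X → L} (hτ : Measurable τ) {θ : Y → L}
    (hθ : Measurable θ) {o : L} {m : L × L → ℝ} {C : ℝ≥0} (hm : ∀ x y, m (x, y) = m (y, x))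
    (hC : ∀ p, |m p| ≤ C) (hm₀ : ∀ l, m (o, l) = 0) (hθm : IsGraphon ν (pullback θ m))
    {M η : ℝ≥0} (hM : μ {x | τ x ≠ o} ≤ M) (hle : ∀ l ≠ o, ν (θ ⁻¹' {l}) ≤ μ (τ ⁻¹' {l}))
    (hη : ∀ l ≠ o, μ (τ ⁻¹' {l}) ≤ ν (θ ⁻¹' {l}) + η) :
    ∃ γ : Measure ((X ⊕ ℝ) × (Y ⊕ ℝ)), IsCouplingMeasure γ (extMeasure μ) (extMeasure ν) ∧
      cutNorm γ (pullback Prod.fst (extFun W) - pullback Prod.snd (extFun (pullback θ m)))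
        ≤ cutNorm μ (W - pullback τ m)
          + 8 * C * (Fintype.card L * η) * (M + Fintype.card L * η) := by
  have := sigmaFinite_extMeasure μ
  have := sigmaFinite_extMeasure ν
  set s : X ⊕ ℝ → L := Sum.elim τ fun _ => o with hs
  set t : Y ⊕ ℝ → L := Sum.elim θ fun _ => o with ht
  have hsm : Measurable s := hτ.sumElim measurable_const
  have htm : Measurable t := hθ.sumElim measurable_const
  have hsl : ∀ l ≠ o, extMeasure μ (s ⁻¹' {l}) = μ (τ ⁻¹' {l}) := fun l hl =>
    extMeasure_preimage_sumElim μ hτ (measurableSet_singleton l) (by simpa using hl.symm)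
  have htl : ∀ l ≠ o, extMeasure ν (t ⁻¹' {l}) = ν (θ ⁻¹' {l}) := fun l hl =>
    extMeasure_preimage_sumElim ν hθ (measurableSet_singleton l) (by simpa using hl.symm)
  have hso : extMeasure μ (s ⁻¹' {o}ᶜ) ≤ M := by
    rw [hs, extMeasure_preimage_sumElim μ hτ (measurableSet_singleton o).compl (by simp)]
    exact hM
  obtain ⟨γ, hγ, hγη⟩ := exists_isCouplingMeasure_labels (extMeasure μ) (extMeasure ν) hsm htm
    (extMeasure_preimage_sumElim_singleton μ hτ o)
    (extMeasure_preimage_sumElim_singleton ν hθ o) (η := η)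
    (fun l hl => by
      refine ((measure_mono ?_).trans_lt (hso.trans_lt ENNReal.coe_lt_top)).ne
      exact preimage_mono (by simpa using hl.symm))
    (fun l hl => by rw [hsl l hl, htl l hl]; exact hle l hl)
    (fun l hl => by rw [hsl l hl, htl l hl]; exact hη l hl)
  refine ⟨γ, hγ, ?_⟩
  have h1 : MeasurePreserving Prod.fst γ (extMeasure μ) := ⟨measurable_fst, hγ.1⟩
  have h2 : MeasurePreserving Prod.snd γ (extMeasure ν) := ⟨measurable_snd, hγ.2⟩
  have : SigmaFinite γ :=
    SigmaFinite.of_map γ measurable_fst.aemeasurable (by rw [hγ.1]; infer_instance)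
  set κ : ℝ≥0∞ := Fintype.card L * η with hκ
  have hγs : γ {z | s z.1 ≠ o} ≤ M := by
    refine le_trans (le_of_eq ?_) hso
    rw [← hγ.1, Measure.map_apply measurable_fst (hsm (measurableSet_singleton o).compl)]
    rfl
  -- If the second label is not `o`, then either the first is not `o` or the two disagree.
  have hγt : γ {z | t z.2 ≠ o} ≤ M + κ := by
    refine le_trans ((measure_mono ?_).trans (measure_union_le _ _)) (add_le_add hγs hγη)
    intro z hz
    by_contra h
    simp only [mem_union, mem_ofPred_eq, not_or, not_not] at h
    exact hz (h.2.symm.trans h.1)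
  have hg : IsGraphon μ (pullback τ m) := isGraphon_pullback_matrix hτ
    (hM.trans_lt ENNReal.coe_lt_top).ne hm hC hm₀
  have hWg : IsGraphon μ (W - pullback τ m) :=
    ⟨fun x y => by simp only [Pi.sub_apply, hW.symm x y, hg.symm x y],
      hW.integrable.sub hg.integrable⟩
  have hi1 := integrable_pullback h1 (isGraphon_extFun hW).integrable
  have hi2 := integrable_pullback h1 (isGraphon_extFun hg).integrable
  have hi3 := integrable_pullback h2 (isGraphon_extFun hθm).integrable
  refine (cutNorm_sub_le hi1 hi2 hi3).trans (add_le_add ?_ ?_)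
  · refine le_trans ?_ (cutNorm_extFun_le hWg)
    rw [extFun_sub]
    exact cutNorm_pullback_le (F := extFun W - extFun (pullback τ m)) h1
      ((isGraphon_extFun hW).integrable.sub (isGraphon_extFun hg).integrable)
  · rw [extFun_pullback_matrix τ hm hm₀, extFun_pullback_matrix θ hm hm₀]
    refine cutNorm_le_lintegral.trans ?_
    have := lintegral_matrix_sub_le (γ := γ) (s := fun z => s z.1) (t := fun z => t z.2)
      (hsm.comp measurable_fst) (htm.comp measurable_snd) hC hm₀
      (fun l => (hm l o).trans (hm₀ l)) hγη (hγs.trans le_self_add) hγt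
    exact this

/-- A graphon that is close in cut norm to a step graphon is close in the cut metric to a finite
weighted graphon with the same matrix and almost the same masses. -/
theorem cutDist_weightedGraphon_le (W : Graphon.{u}) {τ : W.S → L} (hτ : Measurable τ) {o : L}
    {m : L × L → ℝ} {C : ℝ≥0} (hm : ∀ x y, m (x, y) = m (y, x)) (hC : ∀ p, |m p| ≤ C)
    (hm₀ : ∀ l, m (o, l) = 0) {M η : ℝ≥0} (hM : W.μ {x | τ x ≠ o} ≤ M) {b : L → ℝ≥0}
    (hle : ∀ l ≠ o, b l ≤ W.μ (τ ⁻¹' {l})) (hη : ∀ l ≠ o, W.μ (τ ⁻¹' {l}) ≤ b l + η)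
    (hmass : W.μ univ ≠ weightedMeasure.{u} b univ) :
    cutDist W (weightedGraphon b m hm) ≤ cutNorm W.μ (W.W - pullback τ m)
      + 8 * C * (Fintype.card L * η) * (M + Fintype.card L * η) := by
  classical
  have hne : ¬ W.μ univ = (weightedGraphon.{u} b m hm).μ univ := hmass
  rw [cutDist, if_neg hne]
  have := isFiniteMeasure_weightedMeasure.{u} b
  have hb : ∀ l, weightedMeasure.{u} b (ULift.down ⁻¹' {l}) = b l := fun l => by
    rw [weightedMeasure_apply]
    simp
  have hG : IsGraphon (weightedMeasure.{u} b) (pullback ULift.down m) :=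
    (weightedGraphon.{u} b m hm).isGraphon
  obtain ⟨γ, hγ, hle'⟩ := exists_isCouplingMeasure_extFun_cutNorm_le W.isGraphon hτ
    (measurable_down : Measurable (ULift.down : ULift.{u} L → L)) hm hC hm₀
    hG hM (fun l hl => (hb l).trans_le (hle l hl))
    (fun l hl => (hη l hl).trans_eq (congrArg (· + (η : ℝ≥0∞)) (hb l).symm))
  exact (couplingDist_trivialExtension_le W (weightedGraphon b m hm) hγ).trans hle'

/-- The mass at `o` is free because the matrix vanishes there. Of the two choices 0 and 1, at least
one gives a total mass different from that of a given graphon, which selects the trivial-extension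
branch of `cutDist`. -/
theorem weightedMeasure_univ_ite_ne [DecidableEq L] (o : L) (b : L → ℝ≥0) :
    weightedMeasure.{u} (fun l => if l = o then 1 else b l) univ
      ≠ weightedMeasure.{u} (fun l => if l = o then 0 else b l) univ := by
  classical
  have key : ∀ x : ℝ≥0, weightedMeasure.{u} (fun l => if l = o then x else b l) univ
      = ((x + ∑ l ∈ Finset.univ.erase o, b l : ℝ≥0) : ℝ≥0∞) := fun x => by
    rw [weightedMeasure_apply, ← Finset.add_sum_erase _ _ (Finset.mem_univ o)]
    push_cast
    congr 1
    · simp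
    · refine Finset.sum_congr rfl fun l hl => ?_
      simp [Finset.ne_of_mem_erase hl]
  rw [key, key, Ne, ENNReal.coe_inj]
  simp

end WeightedGraphon

/-! ### The finite net, and the equivalence. -/

theorem UniformlyTruncatable.cutTotallyBounded {𝒲 : Set Graphon.{u}}
    (h : UniformlyTruncatable 𝒲) : CutTotallyBounded 𝒲 := by
  classical
  intro ε hε
  obtain ⟨M, B, h⟩ := h (ε / 4) (by positivity)
  obtain ⟨n, c, hstep⟩ := exists_cutNorm_sub_pullback_patternMatrix_le.{u} M B
    (ε := ε / 4) (by positivity)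
  set L := Fin n → Bool × Bool with hL
  set o : L := fun _ => (false, false) with ho
  set C : ℝ≥0 := n * c with hCdef
  have hcard : 0 < (Fintype.card L : ℝ≥0) := by
    have : 0 < Fintype.card L := Fintype.card_pos_iff.2 ⟨o⟩
    exact_mod_cast this
  set ε' : ℝ≥0 := ⟨ε, hε.le⟩ with hε'
  have hε'0 : 0 < ε' := hε
  -- Makes the relabelling error `8Cκ(M + κ)` at most `ε / 4`; with truncation and regularity
  -- costing `ε / 4` each, the sum stays below `ε`.
  set κ : ℝ≥0 := min 1 (ε' / (32 * (C + 1) * (M + 1))) with hκ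
  have hκ0 : 0 < κ := lt_min one_pos (by positivity)
  set η : ℝ≥0 := κ / Fintype.card L with hηdef
  have hη0 : 0 < η := by positivity
  have hκη : Fintype.card L * η = κ := mul_div_cancel₀ _ hcard.ne'
  have herr : 8 * C * κ * (M + κ) ≤ ε' / 4 := by
    calc 8 * C * κ * (M + κ) ≤ 8 * (C + 1) * (ε' / (32 * (C + 1) * (M + 1))) * (M + 1) := by
          gcongr
          · exact le_self_add
          · exact min_le_right _ _
          · exact min_le_left _ _
      _ = ε' / 4 := by
          field_simp
          norm_num
  let b : (L → Fin (⌊M / η⌋₊ + 1)) → L → ℝ≥0 := fun k l => (k l : ℕ) * η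
  -- The net is indexed by the signs of the rectangles, the class masses in multiples of `η`, and
  -- the choice of the mass at `o`.
  let net : (Fin n → Bool) × (L → Fin (⌊M / η⌋₊ + 1)) × Bool → Graphon.{u} := fun q =>
    weightedGraphon (fun l => if l = o then (if q.2.2 then 1 else 0) else b q.2.1 l)
      (patternMatrix c q.1) (patternMatrix_symm c q.1)
  refine ⟨range net, finite_range net, fun W hW => ?_⟩
  obtain ⟨U, V, hU, hUM, hV, hVb, hWV⟩ := h W hW
  obtain ⟨σ, τ, hτ, hτU, hcut⟩ := hstep hU hUM hV hVb
  have hτo : W.μ {x | τ x ≠ o} ≤ M := by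
    refine (measure_mono fun x hx => ?_).trans hUM
    by_contra hxU
    exact hx (hτU x hxU)
  have hl : ∀ l ≠ o, W.μ (τ ⁻¹' {l}) ≤ M := fun l hlo => by
    refine (measure_mono fun x hx => ?_).trans hτo
    have hx' : τ x = l := hx
    exact fun h => hlo (hx'.symm.trans h)
  have hlt : ∀ l, l ≠ o → (W.μ (τ ⁻¹' {l})).toNNReal ≤ M := fun l hlo =>
    ENNReal.toNNReal_mono ENNReal.coe_ne_top (hl l hlo)
  have hcoe : ∀ l, l ≠ o → ((W.μ (τ ⁻¹' {l})).toNNReal : ℝ≥0∞) = W.μ (τ ⁻¹' {l}) :=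
    fun l hlo => ENNReal.coe_toNNReal ((hl l hlo).trans_lt ENNReal.coe_lt_top).ne
  -- Masses are rounded down, so that each class of the net graphon is no heavier than that of W, as
  -- the label coupling requires. The value at `o` plays no role.
  set k : L → Fin (⌊M / η⌋₊ + 1) := fun l => if hlo : l = o then 0 else
    ⟨⌊(W.μ (τ ⁻¹' {l})).toNNReal / η⌋₊,
      Nat.lt_succ_of_le (Nat.floor_mono (div_le_div_of_nonneg_right (hlt l hlo) hη0.le))⟩ with hk
  have hkl : ∀ l ≠ o, b k l = ⌊(W.μ (τ ⁻¹' {l})).toNNReal / η⌋₊ * η := fun l hlo => by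
    simp only [b, hk, dif_neg hlo]
  obtain ⟨z, hz⟩ : ∃ z : Bool, W.μ univ ≠ weightedMeasure.{u}
      (fun l => if l = o then (if z then 1 else 0) else b k l) univ := by
    by_contra! hcon
    have h1 := hcon true
    have h2 := hcon false
    simp only [if_true, Bool.false_eq_true, if_false] at h1 h2
    exact weightedMeasure_univ_ite_ne.{u} o (b k) (h1.symm.trans h2)
  refine ⟨net (σ, k, z), mem_range_self _, ?_⟩
  have hg : IsGraphon W.μ (pullback τ (patternMatrix c σ)) := isGraphon_pullback_matrix hτ
    (hτo.trans_lt ENNReal.coe_lt_top).ne (patternMatrix_symm c σ) (abs_patternMatrix_le c σ)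
    (patternMatrix_zero_left c σ)
  have hdist := cutDist_weightedGraphon_le W hτ (patternMatrix_symm c σ) (abs_patternMatrix_le c σ)
    (patternMatrix_zero_left c σ) hτo (η := η)
    (b := fun l => if l = o then (if z then 1 else 0) else b k l)
    (fun l hlo => by
      rw [if_neg hlo, ← hcoe l hlo, hkl l hlo, ENNReal.coe_le_coe]
      exact (le_div_iff₀ hη0).1 (Nat.floor_le bot_le))
    (fun l hlo => by
      rw [if_neg hlo, ← hcoe l hlo, hkl l hlo, ← ENNReal.coe_add, ENNReal.coe_le_coe,
        ← add_one_mul]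
      exact (div_le_iff₀ hη0).1 (Nat.lt_floor_add_one _).le)
    hz
  have hq : ENNReal.ofReal (ε / 4) = ((ε' / 4 : ℝ≥0) : ℝ≥0∞) := by
    rw [ENNReal.ofReal]
    congr 1
    ext
    rw [Real.coe_toNNReal _ (by positivity)]
    rfl
  have herr' : 8 * ((n * c : ℝ≥0) : ℝ≥0∞) * (Fintype.card L * (η : ℝ≥0∞))
      * (M + Fintype.card L * (η : ℝ≥0∞)) ≤ ENNReal.ofReal (ε / 4) := by
    rw [hq]
    have e : (Fintype.card L : ℝ≥0∞) * (η : ℝ≥0∞) = (κ : ℝ≥0∞) := by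
      rw [← hκη]; push_cast; rfl
    rw [e]
    exact_mod_cast herr
  calc cutDist W (net (σ, k, z)) ≤ cutNorm W.μ (W.W - pullback τ (patternMatrix c σ))
        + ENNReal.ofReal (ε / 4) := hdist.trans (add_le_add le_rfl herr')
    _ ≤ ENNReal.ofReal (ε / 4) + ENNReal.ofReal (ε / 4) + ENNReal.ofReal (ε / 4) :=
        add_le_add ((cutNorm_sub_le W.isGraphon.integrable hV.integrable hg.integrable).trans
          (add_le_add hWV.le hcut)) le_rfl
    _ < ENNReal.ofReal ε := by
        rw [← ENNReal.ofReal_add (by positivity) (by positivity),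
          ← ENNReal.ofReal_add (by positivity) (by positivity), ENNReal.ofReal_lt_ofReal_iff hε]
        linarith

theorem theorem7p2 (𝒲 : Set Graphon.{u}) :
    List.TFAE [
      CutTotallyBounded 𝒲,
      UniformlyCutRegular 𝒲 ∧ HasUniformlyCutRegularTails 𝒲,
      ∀ ε : ℝ, 0 < ε → ∃ M B : ℝ≥0, ∀ W ∈ 𝒲, ∃ (U : Set W.S) (V : W.S × W.S → ℝ),
        MeasurableSet U ∧ W.μ U ≤ M ∧ IsGraphon W.μ V ∧
          (∀ p, |V p| ≤ (U ×ˢ U).indicator (fun _ => (B : ℝ)) p) ∧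
          cutNorm W.μ (W.W - V) < ENNReal.ofReal ε] := by
  change List.TFAE [CutTotallyBounded 𝒲, UniformlyCutRegular 𝒲 ∧ HasUniformlyCutRegularTails 𝒲,
    UniformlyTruncatable 𝒲]
  tfae_have 1 → 3 := CutTotallyBounded.uniformlyTruncatable
  tfae_have 3 → 2 := fun h => ⟨h.uniformlyCutRegular, h.hasUniformlyCutRegularTails⟩
  tfae_have 2 → 3 := fun h => h.1.uniformlyTruncatable h.2
  tfae_have 3 → 1 := UniformlyTruncatable.cutTotallyBounded
  tfae_finish
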